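/- Let $D\subset\mathbb C$ be open with $\overline D=D$, let $\mathbb S=\{I\in\mathbb H: I^2=-1\}$ and let $\Omega_D=\{\alpha+I\beta\in\mathbb H:\alpha,\beta\in\mathbb R,\ \alpha+i\beta\in D,\ I\in\mathbb S\}$. Let $f:\Omega_D\to\mathbb H$ be slice regular, i.e. $f(\alpha+I\beta)=F_0(\alpha+i\beta)+I\,F_1(\alpha+i\beta)$ for all $\alpha+i\beta\in D$ and $I\in\mathbb S$, where $F=F_0+\sqrt{-1}\,F_1:D\to\mathbb H\otimes_{\mathbb R}\mathbb C$ is holomorphic (for the complex structure on $\mathbb H\otimes_{\mathbb R}\mathbb C$ given by multiplication by $\sqrt{-1}$) and $F(\bar z)=\overline{F(z)}=F_0(z)-\sqrt{-1}\,F_1(z)$ for $z\in D$. In general, a slice function $g$ is one induced in this way, $g=\mathcal I(G)$, by a (not necessarily holomorphic) function $G=G_0+\sqrt{-1}\,G_1$ with $G(\bar z)=\overline{G(z)}$. Its spherical derivative is defined at non-real $x$ by $$(\partial_s g)(x)=(2\,\mathrm{Im}\,x)^{-1}\bigl(g(x)-g(x^c)\bigr),$$ where $x^c$ is the quaternionic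 conjugate of $x$ and $\mathrm{Im}\,x=(x-x^c)/2$; if $G$ is continuously differentiable, its slice derivative is $$\partial_c g=\mathcal I\!\left(\frac{\partial G}{\partial z}\right),\qquad \frac{\partial G}{\partial z}=\frac12\left(\frac{\partial G}{\partial\alpha}-\sqrt{-1}\,\frac{\partial G}{\partial\beta}\right),\quad z=\alpha+i\beta.$$ Let $q_0\in\Omega_D\setminus\mathbb R$, put $\Delta_{q_0}(x)=x^2-x(q_0+q_0^c)+q_0q_0^c$ and, for $r>0$, $U(q_0,r)=\{x\in\mathbb H:|\Delta_{q_0}(x)|<r^2\}$. Then there are $r>0$ with $U(q_0,r)\subset\Omega_D$ and quaternions $(s_n)_{n\ge0}$ such that $$f(x)=\sum_{n\ge0}\Delta_{q_0}(x)^n\bigl[s_{2n}+(x-q_0)s_{2n+1}\bigr]\qquad\text{for all }x\in U(q_0,r),\tag{$*$}$$ the series converging unconditionally. Moreover, whenever $r>0$ with $U(q_0,r)\subset\Omega_D$ and quaternions $(s_n)_{n\ge0}$ are such that the partial sums of the series in $(*)$ converge to $f(x)$ for every $x\in U(q_0,r)$, one has for every integer $k\ge0$ $$s_{2k}=\frac1{k!}\bigl((\partial_c\partial_s)^kf\bigr)(q_0),\qquad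 s_{2k+1}=\frac1{k!}\bigl(\partial_s(\partial_c\partial_s)^kf\bigr)(q_0).$$ -/

import Mathlib

open scoped Quaternion

namespace SliceRegular

/-- The sphere `𝕊` of quaternionic imaginary units, `{I : I² = -1}`. -/
def imagUnits : Set ℍ[ℝ] := {I | I ^ 2 = -1}

/-- The circularization `Ω_D = {α + I β : α + i β ∈ D, I ∈ 𝕊}` of `D ⊆ ℂ`. -/
def circularization (D : Set ℂ) : Set ℍ[ℝ] :=
  {x | ∃ z ∈ D, ∃ I ∈ imagUnits, x = (z.re : ℍ[ℝ]) + I * (z.im : ℍ[ℝ])}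

/-- Multiplication by `√-1` on `ℍ ⊗ ℂ = {x + √-1 y : x, y ∈ ℍ}`,
the element `x + √-1 y` being the pair `(x, y)`. -/
def mulSqrtNegOne (w : ℍ[ℝ] × ℍ[ℝ]) : ℍ[ℝ] × ℍ[ℝ] := (-w.2, w.1)

/-- `F = F₀ + √-1 F₁` is a stem function on `D`: `F (conj z)` is the conjugate
`F₀ z - √-1 F₁ z` of `F z`. -/
def IsStem (D : Set ℂ) (F : ℂ → ℍ[ℝ] × ℍ[ℝ]) : Prop :=
  ∀ z ∈ D, F (starRingEnd ℂ z) = ((F z).1, -(F z).2)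

/-- `F` is holomorphic on the open set `D` with respect to the complex structure `√-1` of `ℍ ⊗ ℂ`:
it is real differentiable and its differential is complex linear. -/
def IsHolomorphicStem (D : Set ℂ) (F : ℂ → ℍ[ℝ] × ℍ[ℝ]) : Prop :=
  ∀ z ∈ D, DifferentiableAt ℝ F z ∧
    ∀ v : ℂ, fderiv ℝ F z (Complex.I * v) = mulSqrtNegOne (fderiv ℝ F z v)

/-- `f = 𝓘(F)` on `Ω_D`: `f (α + I β) = F₀ (α + i β) + I F₁ (α + i β)` for all
`α + i β ∈ D` and `I ∈ 𝕊`. -/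
def Induces (D : Set ℂ) (F : ℂ → ℍ[ℝ] × ℍ[ℝ]) (f : ℍ[ℝ] → ℍ[ℝ]) : Prop :=
  ∀ z ∈ D, ∀ I ∈ imagUnits,
    f ((z.re : ℍ[ℝ]) + I * (z.im : ℍ[ℝ])) = (F z).1 + I * (F z).2

/-- `f` is (left) slice regular on `Ω_D`: it is induced by a holomorphic stem function on `D`.
Functions on `Ω_D` are given by total functions, whose values outside `Ω_D` play no role. -/
def IsSliceRegular (D : Set ℂ) (f : ℍ[ℝ] → ℍ[ℝ]) : Prop :=
  ∃ F : ℂ → ℍ[ℝ] × ℍ[ℝ], IsStem D F ∧ IsHolomorphicStem D F ∧ Induces D F f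

/-- The spherical derivative `(∂ₛ f)(x) = (2 Im x)⁻¹ (f x - f xᶜ)`, meaningful at non-real `x`. -/
noncomputable def sphericalDeriv (f : ℍ[ℝ] → ℍ[ℝ]) (x : ℍ[ℝ]) : ℍ[ℝ] :=
  (2 * x.im)⁻¹ * (f x - f (star x))

/-- The stem function of a slice function `f`, read off on the slice `ℂ ⊆ ℍ`:
`F₀ z = (f z + f (conj z)) / 2` and `F₁ z = (2 i)⁻¹ (f z - f (conj z))`. -/
noncomputable def stemOf (f : ℍ[ℝ] → ℍ[ℝ]) (z : ℂ) : ℍ[ℝ] × ℍ[ℝ] :=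
  ((2 : ℍ[ℝ])⁻¹ * (f (z : ℍ[ℝ]) + f (star (z : ℍ[ℝ]))),
    (2 * ((Complex.I : ℂ) : ℍ[ℝ]))⁻¹ * (f (z : ℍ[ℝ]) - f (star (z : ℍ[ℝ]))))

/-- The Wirtinger derivative `∂F/∂z = (1/2) (∂F/∂α - √-1 ∂F/∂β)`, where `z = α + i β`. -/
noncomputable def wirtingerDeriv (F : ℂ → ℍ[ℝ] × ℍ[ℝ]) (z : ℂ) : ℍ[ℝ] × ℍ[ℝ] :=
  (2⁻¹ : ℝ) • (fderiv ℝ F z 1 - mulSqrtNegOne (fderiv ℝ F z Complex.I))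

/-- The function `𝓘(F)`, written with the representation `x = α + I β` in which `α = Re x`,
`β = |Im x|` and `I = Im x / |Im x|`. (At a real `x` the second term is zero, as it must
be for a stem function.) -/
noncomputable def induced (F : ℂ → ℍ[ℝ] × ℍ[ℝ]) (x : ℍ[ℝ]) : ℍ[ℝ] :=
  (F ⟨x.re, ‖x.im‖⟩).1 + (‖x.im‖⁻¹ • x.im) * (F ⟨x.re, ‖x.im‖⟩).2

/-- The slice derivative `∂_c f = 𝓘(∂F/∂z)` of a slice function `f = 𝓘(F)`. -/
noncomputable def sliceDeriv (f : ℍ[ℝ] → ℍ[ℝ]) : ℍ[ℝ] → ℍ[ℝ] :=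
  induced (wirtingerDeriv (stemOf f))

/-- The characteristic polynomial `Δ_q(x) = x² - x (q + qᶜ) + q qᶜ`. -/
noncomputable def charPoly (q x : ℍ[ℝ]) : ℍ[ℝ] := x ^ 2 - x * (q + star q) + q * star q

/-- The Cassini ball `U(q, r) = {x : |Δ_q(x)| < r²}`. -/
def cassiniBall (q : ℍ[ℝ]) (r : ℝ) : Set ℍ[ℝ] := {x | ‖charPoly q x‖ < r ^ 2}

/-- The `n`-th term `Δ_q(x)ⁿ [s_{2n} + (x - q) s_{2n+1}]` of the spherical expansion at `q`
with coefficients `s`. -/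
noncomputable def sphericalTerm (q : ℍ[ℝ]) (s : ℕ → ℍ[ℝ]) (x : ℍ[ℝ]) (n : ℕ) : ℍ[ℝ] :=
  charPoly q x ^ n * (s (2 * n) + (x - q) * s (2 * n + 1))

/-- The stem function inducing `f` is unique on `D`, and it is the one recovered by `stemOf`. -/
theorem stemOf_eq {D : Set ℂ} (hD : ∀ z ∈ D, starRingEnd ℂ z ∈ D) {F : ℂ → ℍ[ℝ] × ℍ[ℝ]}
    {f : ℍ[ℝ] → ℍ[ℝ]} (hF : IsStem D F) (hf : Induces D F f) {z : ℂ} (hz : z ∈ D) :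
    stemOf f z = F z := by
  have hI : ((Complex.I : ℂ) : ℍ[ℝ]) ∈ imagUnits := by
    change _ ^ 2 = _
    rw [sq, ← Quaternion.coeComplex_mul, Complex.I_mul_I]
    ext <;> simp
  have h1 := hf z hz _ hI
  have h2 := hf _ (hD z hz) _ hI
  have e1 : (z.re : ℍ[ℝ]) + ((Complex.I : ℂ) : ℍ[ℝ]) * (z.im : ℍ[ℝ]) = (z : ℍ[ℝ]) := by
    ext <;> simp
  have e2 : ((starRingEnd ℂ z).re : ℍ[ℝ]) + ((Complex.I : ℂ) : ℍ[ℝ]) *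
      ((starRingEnd ℂ z).im : ℍ[ℝ]) = star (z : ℍ[ℝ]) := by
    ext <;> simp
  rw [e1] at h1
  rw [e2, hF z hz] at h2
  have hI0 : ((Complex.I : ℂ) : ℍ[ℝ]) ≠ 0 := by
    intro h
    have := congrArg (fun q : ℍ[ℝ] => q.imI) h
    simp at this
  have h20 : (2 : ℍ[ℝ]) ≠ 0 := by
    have h : ((2 : ℝ) : ℍ[ℝ]) ≠ 0 := by
      rw [Ne, ← Quaternion.coe_zero, Quaternion.coe_inj]
      exact two_ne_zero
    exact_mod_cast h
  unfold stemOf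
  rw [h1, h2]
  ext1
  · rw [inv_mul_eq_iff_eq_mul₀ h20]
    simp only [mul_neg, two_mul]
    abel
  · rw [inv_mul_eq_iff_eq_mul₀ (mul_ne_zero h20 hI0)]
    simp only [mul_neg, two_mul, add_mul]
    abel

end SliceRegular

/-! Composing a stem function with a real functional of `ℍ` gives a holomorphic `u` on `D` that
commutes with conjugation. On each slice, `Δ_{q₀}` becomes the real quadratic `Q(z) = (z - a)² +
b²`, where `a = Re q₀` and `b = |Im q₀|`. With `p_n = s_{2n} - q₀ s_{2n+1}` and `q_n = s_{2n+1}`,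
the quaternionic expansion amounts, coordinate by coordinate, to `u(z) = ∑ Q(z)ⁿ (p_n + z q_n)` with
real coefficients.

Existence: for `|w| < b²` the equation `Q(z) = w` has two distinct roots. Interpolating `u` linearly
between them gives `u(z) = A(Q(z)) + z B(Q(z))` with `A`, `B` holomorphic, and their Taylor series
at 0 give the expansion (`exists_complex_expansion`). Averaging with the conjugate expansion makes
the coefficients real.

Coefficients: let `S u = Im u / Im z` and `u_k = (∂ S)^k u`. These iterates satisfy `∂̄ u_k = k S
u_k` (`dzbar_altSeq`), which yields the Leibniz rule `(Q u)_k = Q u_k + k ((z + z̄ - 2a) S u_{k-1} +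
u_{k-1})` (`altSeq_quad_mul`). At the root `z₀ = a + i b` both `Q` and `z + z̄ - 2a` vanish, so
splitting off one term of the series at a time gives `u_k(z₀) = k! (p_k + z₀ q_k)` (`altSeq_root`).
Pointwise convergence is enough: it bounds the coefficients geometrically (`exists_coeff_bound`), so
the series and its tails are holomorphic near `z₀`. Finally, `iterate_slice` identifies the iterates
of `∂_c ∂_s` on `f` with those on stem functions. -/

namespace SliceRegular

open Filter
open scoped ContDiff

/-! ### Expansions of holomorphic functions in powers of a real quadratic polynomial -/

/-- The real quadratic polynomial with roots `a ± i b`. -/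
noncomputable def quad (a b : ℝ) (z : ℂ) : ℂ := (z - a) ^ 2 + b ^ 2

theorem quad_conj (a b : ℝ) (z : ℂ) :
    quad a b (starRingEnd ℂ z) = starRingEnd ℂ (quad a b z) := by
  simp [quad]

/-- A branch of the square root of `b² - w` for `|w| < b²`. -/
theorem exists_sqrt_sub {b : ℝ} :
    ∃ s : ℂ → ℂ, DifferentiableOn ℂ s (Metric.ball 0 (b ^ 2)) ∧ ∀ w, s w ^ 2 = b ^ 2 - w := by
  refine ⟨fun w => ((b : ℂ) ^ 2 - w) ^ ((2 : ℕ) : ℂ)⁻¹, ?_, fun w =>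
    Complex.cpow_nat_inv_pow _ two_ne_zero⟩
  intro w hw
  have hw' : ‖w‖ < b ^ 2 := by simpa using hw
  -- The values `b² - w` stay in the right half-plane, where the principal branch is holomorphic.
  have hre : 0 < ((b : ℂ) ^ 2 - w).re := by
    have h1 := Complex.re_le_norm w
    have : ((b : ℂ) ^ 2 - w).re = b ^ 2 - w.re := by
      rw [← Complex.ofReal_pow, Complex.sub_re, Complex.ofReal_re]
    rw [this]; linarith
  refine DifferentiableAt.differentiableWithinAt ?_
  exact ((differentiableAt_const _).sub differentiableAt_id).cpow (differentiableAt_const _)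
    (Complex.mem_slitPlane_iff.2 (Or.inl hre))

/-- Expansion in powers of a quadratic polynomial with linear coefficients. -/
theorem exists_complex_expansion {D : Set ℂ} {g : ℂ → ℂ} (hg : ∀ z ∈ D, DifferentiableAt ℂ g z)
    {a b r : ℝ} (hr : 0 < r) (hrb : r ≤ b) (hU : ∀ z, ‖quad a b z‖ < r ^ 2 → z ∈ D) :
    ∃ p q : ℕ → ℂ, ∀ z, ‖quad a b z‖ < r ^ 2 →
      HasSum (fun n => quad a b z ^ n * (p n + z * q n)) (g z) := by
  obtain ⟨s, hsd, hs⟩ := exists_sqrt_sub (b := b)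
  have hsub : Metric.ball (0 : ℂ) (r ^ 2) ⊆ Metric.ball 0 (b ^ 2) :=
    Metric.ball_subset_ball (by gcongr)
  -- A zero of `s` forces `w = b²`, which `r ≤ b` keeps out of the disc; the two roots therefore
  -- stay distinct.
  have hs0 : ∀ w ∈ Metric.ball (0 : ℂ) (r ^ 2), s w ≠ 0 := by
    intro w hw h0
    have h1 : ‖w‖ < b ^ 2 := by simpa using hsub hw
    have h2 := hs w
    rw [h0] at h2
    have h3 : w = (b : ℂ) ^ 2 := by linear_combination h2
    rw [h3] at h1
    simp at h1
  have hdiff : ∀ c : ℂ, c ^ 2 = -1 →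
      DifferentiableOn ℂ (fun w => g (a + c * s w)) (Metric.ball 0 (r ^ 2)) := by
    intro c hc w hw
    have hD : (a + c * s w : ℂ) ∈ D := by
      apply hU
      have : quad a b (a + c * s w) = w := by
        have := hs w
        simp only [quad]
        linear_combination (s w) ^ 2 * hc - this
      rw [this]; simpa using hw
    have h1 : DifferentiableAt ℂ s w :=
      (hsd w (hsub hw)).differentiableAt (Metric.isOpen_ball.mem_nhds (hsub hw))
    exact (DifferentiableAt.comp w (g := g) (f := fun w => (a + c * s w : ℂ)) (hg _ hD)
      ((h1.const_mul c).const_add _)).differentiableWithinAt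
  have hsd' := hsd.mono hsub
  have hp := hdiff Complex.I Complex.I_sq
  have hm := hdiff (-Complex.I) (by rw [neg_sq, Complex.I_sq])
  -- `A w + z * B w` is the linear interpolation of `g` at the two roots `a ± i s(w)` of `quad a b z
  -- = w`: `B` is the slope and `A` the intercept.
  obtain ⟨B, hBdef⟩ : ∃ B : ℂ → ℂ, B = fun w =>
    (g (a + Complex.I * s w) - g (a + -Complex.I * s w)) / (2 * Complex.I * s w) := ⟨_, rfl⟩
  obtain ⟨A, hAdef⟩ : ∃ A : ℂ → ℂ, A = fun w =>
    g (a + Complex.I * s w) - (a + Complex.I * s w) * B w := ⟨_, rfl⟩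
  have hB : DifferentiableOn ℂ B (Metric.ball 0 (r ^ 2)) := by
    rw [hBdef]
    refine (hp.sub hm).div (hsd'.const_mul _) fun w hw => ?_
    simpa using hs0 w hw
  have hA : DifferentiableOn ℂ A (Metric.ball 0 (r ^ 2)) := by
    rw [hAdef]
    exact hp.sub (((hsd'.const_mul _).const_add _).mul hB)
  refine ⟨fun n => (n.factorial : ℂ)⁻¹ * iteratedDeriv n A 0,
    fun n => (n.factorial : ℂ)⁻¹ * iteratedDeriv n B 0, fun z hz => ?_⟩
  have hw : quad a b z ∈ Metric.ball (0 : ℂ) (r ^ 2) := by simpa using hz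
  have h1 := (Complex.hasSum_taylorSeries_on_ball hA hw).add
    ((Complex.hasSum_taylorSeries_on_ball hB hw).mul_left z)
  have hval : A (quad a b z) + z * B (quad a b z) = g z := by
    rw [hAdef, hBdef]
    set w := quad a b z with hwdef
    have hsw := hs0 w hw
    beta_reduce
    -- The point `z` is itself one of the two interpolation nodes for `w = quad a b z`.
    have hz2 : (z - a - Complex.I * s w) * (z - a + Complex.I * s w) = 0 := by
      have h2 := hs w
      have h3 : w = (z - a) ^ 2 + b ^ 2 := rfl
      linear_combination (-(s w) ^ 2) * Complex.I_sq + h2 - h3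
    rcases mul_eq_zero.1 hz2 with h | h
    · have e : z = a + Complex.I * s w := by linear_combination h
      rw [← e]; ring
    · have e : z = a + -Complex.I * s w := by linear_combination h
      rw [← e]
      have e2 : z - (a + Complex.I * s w) = -(2 * Complex.I * s w) := by linear_combination h
      have hne : 2 * Complex.I * s w ≠ 0 := by simpa using hsw
      generalize g (a + Complex.I * s w) = G
      have : (z - (a + Complex.I * s w)) * ((G - g z) / (2 * Complex.I * s w)) = -(G - g z) := by
        rw [e2]; field_simp
      linear_combination this
  rw [hval] at h1
  refine Eq.subst (motive := fun F => HasSum F (g z)) (funext fun n => ?_) h1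
  simp only [smul_eq_mul, sub_zero]
  ring

/-- The expansion of a function commuting with conjugation has real coefficients. -/
theorem exists_real_expansion {D : Set ℂ} {g : ℂ → ℂ} (hg : ∀ z ∈ D, DifferentiableAt ℂ g z)
    (hgc : ∀ z ∈ D, g (starRingEnd ℂ z) = starRingEnd ℂ (g z))
    {a b r : ℝ} (hr : 0 < r) (hrb : r ≤ b) (hU : ∀ z, ‖quad a b z‖ < r ^ 2 → z ∈ D) :
    ∃ p q : ℕ → ℝ, ∀ z, ‖quad a b z‖ < r ^ 2 →
      HasSum (fun n => quad a b z ^ n * (p n + z * q n)) (g z) := by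
  obtain ⟨p, q, h⟩ := exists_complex_expansion hg hr hrb hU
  refine ⟨fun n => (p n).re, fun n => (q n).re, fun z hz => ?_⟩
  have hz' : ‖quad a b (starRingEnd ℂ z)‖ < r ^ 2 := by
    rwa [quad_conj, RCLike.norm_conj]
  have h1 := h z hz
  have h2 := h _ hz'
  rw [hgc z (hU z hz), ← Complex.hasSum_conj] at h2
  -- Conjugating the expansion at `z̄` gives one at `z` with conjugate coefficients; the mean of the
  -- two has real coefficients.
  have h3 := (h1.add h2).mul_left (2⁻¹ : ℂ)
  rw [show (2⁻¹ : ℂ) * (g z + g z) = g z by ring] at h3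
  refine Eq.subst (motive := fun F => HasSum F (g z)) (funext fun n => ?_) h3
  simp only [quad_conj, map_mul, map_add, map_pow, Complex.conj_conj, Complex.re_eq_add_conj]
  ring

/-! ### Wirtinger calculus -/

/-- The Wirtinger derivative `∂/∂z` of a complex valued function. -/
noncomputable def dz (u : ℂ → ℂ) (z : ℂ) : ℂ :=
  2⁻¹ * (fderiv ℝ u z 1 - Complex.I * fderiv ℝ u z Complex.I)

/-- The Wirtinger derivative `∂/∂z̄` of a complex valued function. -/
noncomputable def dzbar (u : ℂ → ℂ) (z : ℂ) : ℂ :=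
  2⁻¹ * (fderiv ℝ u z 1 + Complex.I * fderiv ℝ u z Complex.I)

section Wirtinger

variable {u v : ℂ → ℂ} {z : ℂ}

theorem dz_congr (h : u =ᶠ[nhds z] v) : dz u z = dz v z := by
  simp only [dz, h.fderiv_eq]

theorem dzbar_congr (h : u =ᶠ[nhds z] v) : dzbar u z = dzbar v z := by
  simp only [dzbar, h.fderiv_eq]

theorem dz_add (hu : DifferentiableAt ℝ u z) (hv : DifferentiableAt ℝ v z) :
    dz (fun x => u x + v x) z = dz u z + dz v z := by
  simp only [dz, fderiv_fun_add hu hv, add_apply]; ring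

theorem dz_sub (hu : DifferentiableAt ℝ u z) (hv : DifferentiableAt ℝ v z) :
    dz (fun x => u x - v x) z = dz u z - dz v z := by
  simp only [dz, fderiv_fun_sub hu hv, sub_apply]; ring

theorem dzbar_sub (hu : DifferentiableAt ℝ u z) (hv : DifferentiableAt ℝ v z) :
    dzbar (fun x => u x - v x) z = dzbar u z - dzbar v z := by
  simp only [dzbar, fderiv_fun_sub hu hv, sub_apply]; ring

theorem dz_mul (hu : DifferentiableAt ℝ u z) (hv : DifferentiableAt ℝ v z) :
    dz (fun x => u x * v x) z = u z * dz v z + v z * dz u z := by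
  simp only [dz, fderiv_fun_mul hu hv, add_apply,
    smul_apply, smul_eq_mul]; ring

theorem dzbar_mul (hu : DifferentiableAt ℝ u z) (hv : DifferentiableAt ℝ v z) :
    dzbar (fun x => u x * v x) z = u z * dzbar v z + v z * dzbar u z := by
  simp only [dzbar, fderiv_fun_mul hu hv, add_apply,
    smul_apply, smul_eq_mul]; ring

theorem dz_const_mul (c : ℂ) (hu : DifferentiableAt ℝ u z) :
    dz (fun x => c * u x) z = c * dz u z := by
  simp only [dz, fderiv_const_mul hu, smul_apply, smul_eq_mul]; ring

theorem dzbar_const_mul (c : ℂ) (hu : DifferentiableAt ℝ u z) :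
    dzbar (fun x => c * u x) z = c * dzbar u z := by
  simp only [dzbar, fderiv_const_mul hu, smul_apply, smul_eq_mul]; ring

theorem dz_const (c : ℂ) : dz (fun _ => c) z = 0 := by simp [dz]

theorem differentiableAt_conj (hu : DifferentiableAt ℝ u z) :
    DifferentiableAt ℝ (fun x => starRingEnd ℂ (u x)) z :=
  Complex.conjCLE.differentiableAt.comp z hu

theorem dz_conj (hu : DifferentiableAt ℝ u z) :
    dz (fun x => starRingEnd ℂ (u x)) z = starRingEnd ℂ (dzbar u z) := by
  have : fderiv ℝ (fun x => starRingEnd ℂ (u x)) z =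
      (Complex.conjCLE : ℂ →L[ℝ] ℂ).comp (fderiv ℝ u z) :=
    ((Complex.conjCLE : ℂ →L[ℝ] ℂ).hasFDerivAt.comp z hu.hasFDerivAt).fderiv
  simp only [dz, dzbar, this]
  simp [Complex.conj_ofNat]
  ring

theorem dzbar_conj (hu : DifferentiableAt ℝ u z) :
    dzbar (fun x => starRingEnd ℂ (u x)) z = starRingEnd ℂ (dz u z) := by
  have : fderiv ℝ (fun x => starRingEnd ℂ (u x)) z =
      (Complex.conjCLE : ℂ →L[ℝ] ℂ).comp (fderiv ℝ u z) :=
    ((Complex.conjCLE : ℂ →L[ℝ] ℂ).hasFDerivAt.comp z hu.hasFDerivAt).fderiv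
  simp only [dz, dzbar, this]
  simp [Complex.conj_ofNat]

theorem dzbar_of_differentiableAt (hu : DifferentiableAt ℂ u z) : dzbar u z = 0 := by
  have h := (differentiableAt_complex_iff_differentiableAt_real.1 hu).2
  simp only [dzbar, h, smul_eq_mul]
  linear_combination 2⁻¹ * fderiv ℝ u z 1 * Complex.I_mul_I

theorem dz_id : dz (fun x => x) z = 1 := by
  simp [dz, fderiv_fun_id]
  norm_num

theorem dzbar_id : dzbar (fun x => x) z = 0 := dzbar_of_differentiableAt differentiableAt_fun_id

theorem contDiffOn_dz {W : Set ℂ} (hW : IsOpen W) (hu : ContDiffOn ℝ ∞ u W) :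
    ContDiffOn ℝ ∞ (dz u) W := by
  have h := hu.fderiv_of_isOpen (m := ∞) hW (by simp)
  exact contDiffOn_const.mul ((h.clm_apply contDiffOn_const).sub
    (contDiffOn_const.mul (h.clm_apply contDiffOn_const)))

/-- The two sides differ only in the mixed second derivatives, which agree by symmetry for smooth
`u`. -/
theorem dzbar_dz_comm (hu : ContDiffAt ℝ ∞ u z) : dzbar (dz u) z = dz (dzbar u) z := by
  have hsymm : IsSymmSndFDerivAt ℝ u z := hu.isSymmSndFDerivAt (by simp only [minSmoothness_of_isRCLikeNormedField]; exact WithTop.coe_le_coe.2 (le_top : (2 : ℕ∞) ≤ ⊤))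
  have hd : DifferentiableAt ℝ (fderiv ℝ u) z :=
    (hu.fderiv_right (m := ∞) (by simp)).differentiableAt (by simp)
  have hc : ∀ c : ℂ, DifferentiableAt ℝ (fun x => fderiv ℝ u x c) z := fun c =>
    hd.clm_apply (differentiableAt_const c)
  have hcv : ∀ c v : ℂ, fderiv ℝ (fun x => fderiv ℝ u x c) z v =
      fderiv ℝ (fderiv ℝ u) z v c := by
    intro c v
    rw [fderiv_clm_apply hd (differentiableAt_const c)]
    simp
  have e1 : ∀ v, fderiv ℝ (dz u) z v = 2⁻¹ * (fderiv ℝ (fderiv ℝ u) z v 1 -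
      Complex.I * fderiv ℝ (fderiv ℝ u) z v Complex.I) := by
    intro v
    change fderiv ℝ (fun z => 2⁻¹ * (fderiv ℝ u z 1 - Complex.I * fderiv ℝ u z Complex.I)) z v = _
    rw [fderiv_const_mul (a := fun z => fderiv ℝ u z 1 - Complex.I * fderiv ℝ u z Complex.I)
        ((hc 1).sub ((hc _).const_mul _)), fderiv_fun_sub (hc 1) ((hc _).const_mul _),
      fderiv_const_mul (hc _)]
    simp [hcv]
  have e2 : ∀ v, fderiv ℝ (dzbar u) z v = 2⁻¹ * (fderiv ℝ (fderiv ℝ u) z v 1 +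
      Complex.I * fderiv ℝ (fderiv ℝ u) z v Complex.I) := by
    intro v
    change fderiv ℝ (fun z => 2⁻¹ * (fderiv ℝ u z 1 + Complex.I * fderiv ℝ u z Complex.I)) z v = _
    rw [fderiv_const_mul (a := fun z => fderiv ℝ u z 1 + Complex.I * fderiv ℝ u z Complex.I)
        ((hc 1).add ((hc _).const_mul _)), fderiv_fun_add (hc 1) ((hc _).const_mul _),
      fderiv_const_mul (hc _)]
    simp [hcv, mul_add]
  rw [dzbar, dz, e1, e1, e2, e2, hsymm Complex.I 1]
  ring

end Wirtinger

/-! ### Iterated spherical and Wirtinger derivatives of complex functions -/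

/-- The spherical derivative on the level of stem functions. -/
noncomputable def sph (u : ℂ → ℂ) (z : ℂ) : ℂ := (((u z).im / z.im : ℝ) : ℂ)

/-- The iterates of the composition of the spherical and the slice derivative, on the level of
stem functions. -/
noncomputable def altSeq (u : ℂ → ℂ) : ℕ → ℂ → ℂ
  | 0 => u
  | k + 1 => dz (sph (altSeq u k))

theorem sub_conj_mul_sph (u : ℂ → ℂ) {z : ℂ} (hz : z.im ≠ 0) :
    (z - starRingEnd ℂ z) * sph u z = u z - starRingEnd ℂ (u z) := by
  rw [Complex.sub_conj, Complex.sub_conj, sph]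
  have : (z.im : ℂ) ≠ 0 := by exact_mod_cast hz
  push_cast
  field_simp

theorem conj_sph (u : ℂ → ℂ) (z : ℂ) : starRingEnd ℂ (sph u z) = sph u z :=
  Complex.conj_ofReal _

theorem sph_eq_of {u : ℂ → ℂ} {z v : ℂ} (hz : z.im ≠ 0)
    (h : (z - starRingEnd ℂ z) * v = u z - starRingEnd ℂ (u z)) : sph u z = v := by
  have hne : z - starRingEnd ℂ z ≠ 0 := by
    rw [Complex.sub_conj]; simpa using hz
  exact mul_left_cancel₀ hne ((sub_conj_mul_sph u hz).trans h.symm)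

theorem contDiffOn_sph {W : Set ℂ} (hWim : ∀ z ∈ W, 0 < z.im) {u : ℂ → ℂ}
    (hu : ContDiffOn ℝ ∞ u W) : ContDiffOn ℝ ∞ (sph u) W := by
  have h1 : ContDiffOn ℝ ∞ (fun z => (u z).im / z.im) W :=
    (Complex.imCLM.contDiff.comp_contDiffOn hu).div Complex.imCLM.contDiff.contDiffOn
      fun z hz => (hWim z hz).ne'
  exact Complex.ofRealCLM.contDiff.comp_contDiffOn h1

theorem contDiffOn_altSeq {W : Set ℂ} (hW : IsOpen W) (hWim : ∀ z ∈ W, 0 < z.im) {u : ℂ → ℂ}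
    (hu : DifferentiableOn ℂ u W) (k : ℕ) : ContDiffOn ℝ ∞ (altSeq u k) W := by
  induction k with
  | zero => exact (hu.contDiffOn hW).restrict_scalars ℝ
  | succ k ih => exact contDiffOn_dz hW (contDiffOn_sph hWim ih)

theorem altSeq_differentiableAt {W : Set ℂ} (hW : IsOpen W) (hWim : ∀ z ∈ W, 0 < z.im)
    {u : ℂ → ℂ} (hu : DifferentiableOn ℂ u W) (k : ℕ) {z : ℂ} (hz : z ∈ W) :
    DifferentiableAt ℝ (altSeq u k) z :=
  ((contDiffOn_altSeq hW hWim hu k).contDiffAt (hW.mem_nhds hz)).differentiableAt (by simp)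

theorem sph_altSeq_differentiableAt {W : Set ℂ} (hW : IsOpen W) (hWim : ∀ z ∈ W, 0 < z.im)
    {u : ℂ → ℂ} (hu : DifferentiableOn ℂ u W) (k : ℕ) {z : ℂ} (hz : z ∈ W) :
    DifferentiableAt ℝ (sph (altSeq u k)) z :=
  ((contDiffOn_sph hWim (contDiffOn_altSeq hW hWim hu k)).contDiffAt
    (hW.mem_nhds hz)).differentiableAt (by simp)

theorem differentiableAt_sub_conj (z : ℂ) :
    DifferentiableAt ℝ (fun x : ℂ => x - starRingEnd ℂ x) z :=
  differentiableAt_fun_id.sub (differentiableAt_conj differentiableAt_fun_id)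

theorem dz_id_conj (z : ℂ) : dz (fun x => starRingEnd ℂ x) z = 0 := by
  rw [dz_conj differentiableAt_fun_id, dzbar_id, map_zero]

theorem dzbar_id_conj (z : ℂ) : dzbar (fun x => starRingEnd ℂ x) z = 1 := by
  rw [dzbar_conj differentiableAt_fun_id, dz_id, map_one]

theorem dz_sub_conj (z : ℂ) : dz (fun x => x - starRingEnd ℂ x) z = 1 := by
  rw [dz_sub differentiableAt_fun_id (differentiableAt_conj differentiableAt_fun_id), dz_id, dz_id_conj, sub_zero]

theorem dzbar_sub_conj (z : ℂ) : dzbar (fun x => x - starRingEnd ℂ x) z = -1 := by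
  rw [dzbar_sub differentiableAt_fun_id (differentiableAt_conj differentiableAt_fun_id), dzbar_id, dzbar_id_conj,
    zero_sub]

/-- The two Wirtinger derivatives of a real-valued function are conjugate to each other. -/
theorem conj_dz_sph {u : ℂ → ℂ} {z : ℂ} (h : DifferentiableAt ℝ (sph u) z) :
    starRingEnd ℂ (dz (sph u) z) = dzbar (sph u) z := by
  rw [← dzbar_conj h]
  simp only [conj_sph]

/-- Apply `∂` to `(z - z̄) S u_k = u_k - conj u_k`. The last term contributes `conj (∂̄ u_k)`, which
is `k S u_k` by hypothesis because `S u_k` is real. -/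
theorem sub_conj_mul_altSeq_succ {W : Set ℂ} (hW : IsOpen W) (hWim : ∀ z ∈ W, 0 < z.im)
    {u : ℂ → ℂ} (hu : DifferentiableOn ℂ u W) {k : ℕ} {z : ℂ} (hz : z ∈ W)
    (h : dzbar (altSeq u k) z = k * sph (altSeq u k) z) :
    (z - starRingEnd ℂ z) * altSeq u (k + 1) z =
      dz (altSeq u k) z - (k + 1) * sph (altSeq u k) z := by
  have hd := altSeq_differentiableAt hW hWim hu k hz
  have hs := sph_altSeq_differentiableAt hW hWim hu k hz
  have e : dz (fun x => (x - starRingEnd ℂ x) * sph (altSeq u k) x) z =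
      dz (fun x => altSeq u k x - starRingEnd ℂ (altSeq u k x)) z :=
    dz_congr ((hW.eventually_mem hz).mono fun x hx => sub_conj_mul_sph _ (hWim x hx).ne')
  rw [dz_mul (differentiableAt_sub_conj z) hs, dz_sub hd
    (differentiableAt_conj hd), dz_conj hd, h, dz_sub_conj, map_mul, conj_sph,
    Complex.conj_natCast] at e
  change (z - starRingEnd ℂ z) * dz (sph (altSeq u k)) z = _
  linear_combination e

/-- The iterates satisfy an equation of Euler-Poisson-Darboux type. -/
theorem dzbar_altSeq {W : Set ℂ} (hW : IsOpen W) (hWim : ∀ z ∈ W, 0 < z.im)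
    {u : ℂ → ℂ} (hu : DifferentiableOn ℂ u W) (k : ℕ) {z : ℂ} (hz : z ∈ W) :
    dzbar (altSeq u k) z = k * sph (altSeq u k) z := by
  induction k generalizing z with
  | zero =>
    rw [Nat.cast_zero, zero_mul]
    exact dzbar_of_differentiableAt (hu.differentiableAt (hW.mem_nhds hz))
  | succ k ih =>
    have hd := altSeq_differentiableAt hW hWim hu (k + 1) hz
    have hs := sph_altSeq_differentiableAt hW hWim hu k hz
    have hdz : DifferentiableAt ℝ (dz (altSeq u k)) z :=
      ((contDiffOn_dz hW (contDiffOn_altSeq hW hWim hu k)).contDiffAt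
        (hW.mem_nhds hz)).differentiableAt (by simp)
    -- Apply `∂̄` to the formula for `(z - z̄) u_{k+1}`. Since `∂̄ ∂ u_k = ∂ ∂̄ u_k = k u_{k+1}` and
    -- `∂̄ S u_k = conj u_{k+1}`, the result is `(z - z̄) ∂̄ u_{k+1} = (k + 1) (u_{k+1} - conj
    -- u_{k+1})`.
    have e : dzbar (fun x => (x - starRingEnd ℂ x) * altSeq u (k + 1) x) z =
        dzbar (fun x => dz (altSeq u k) x - ((k : ℂ) + 1) * sph (altSeq u k) x) z :=
      dzbar_congr ((hW.eventually_mem hz).mono fun x hx =>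
        sub_conj_mul_altSeq_succ hW hWim hu hx (ih hx))
    have e2 : dz (dzbar (altSeq u k)) z = dz (fun x => (k : ℂ) * sph (altSeq u k) x) z :=
      dz_congr ((hW.eventually_mem hz).mono fun x hx => ih hx)
    rw [dz_const_mul _ hs] at e2
    rw [dzbar_mul (differentiableAt_sub_conj z) hd, dzbar_sub_conj,
      dzbar_sub hdz (hs.const_mul _), dzbar_const_mul _ hs, dzbar_dz_comm
        ((contDiffOn_altSeq hW hWim hu k).contDiffAt (hW.mem_nhds hz)), e2, ← conj_dz_sph hs] at e
    have e3 := sub_conj_mul_sph (altSeq u (k + 1)) (hWim z hz).ne'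
    have hne : z - starRingEnd ℂ z ≠ 0 := by
      rw [Complex.sub_conj]; simpa using (hWim z hz).ne'
    apply mul_left_cancel₀ hne
    change _ + altSeq u (k + 1) z * -1 = k * altSeq u (k + 1) z -
      (k + 1) * starRingEnd ℂ (altSeq u (k + 1) z) at e
    push_cast
    linear_combination e - (k + 1 : ℂ) * e3

theorem quad_differentiable (a b : ℝ) : Differentiable ℂ (quad a b) := by
  unfold quad; fun_prop

/-- A Leibniz rule for the iterates and multiplication by a quadratic polynomial. -/
theorem altSeq_quad_mul {W : Set ℂ} (hW : IsOpen W) (hWim : ∀ z ∈ W, 0 < z.im)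
    {u : ℂ → ℂ} (hu : DifferentiableOn ℂ u W) (a b : ℝ) (k : ℕ) {z : ℂ} (hz : z ∈ W) :
    altSeq (fun x => quad a b x * u x) k z = quad a b z * altSeq u k z +
      k * ((z + starRingEnd ℂ z - 2 * a) * sph (altSeq u (k - 1)) z + altSeq u (k - 1) z) := by
  induction k generalizing z with
  | zero => simp [altSeq]
  | succ k ih =>
    have hd := altSeq_differentiableAt hW hWim hu k hz
    have hs := sph_altSeq_differentiableAt hW hWim hu k hz
    have hs1 := sph_altSeq_differentiableAt hW hWim hu (k - 1) hz
    -- This rests on `Q - Q̄ = (z - z̄) (z + z̄ - 2a)`; the real term `(z + z̄ - 2a) S u_{k-1}`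
    -- drops out of the imaginary part.
    have e : ∀ x ∈ W, sph (altSeq (fun x => quad a b x * u x) k) x =
        starRingEnd ℂ (quad a b x) * sph (altSeq u k) x +
          ((x + starRingEnd ℂ x - 2 * a) * altSeq u k x + k * sph (altSeq u (k - 1)) x) := by
      intro x hx
      apply sph_eq_of (hWim x hx).ne'
      rw [ih hx]
      have h1 := sub_conj_mul_sph (altSeq u k) (hWim x hx).ne'
      have h2 := sub_conj_mul_sph (altSeq u (k - 1)) (hWim x hx).ne'
      simp only [map_add, map_mul, map_sub, Complex.conj_conj, Complex.conj_natCast,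
        Complex.conj_ofReal, conj_sph, Complex.conj_ofNat]
      simp only [quad, map_add, map_sub, map_pow, Complex.conj_ofReal]
      linear_combination ((starRingEnd ℂ x - a) ^ 2 + b ^ 2 : ℂ) * h1 + (k : ℂ) * h2
    have hq : DifferentiableAt ℝ (fun x => starRingEnd ℂ (quad a b x)) z :=
      differentiableAt_conj (((quad_differentiable a b) z).restrictScalars ℝ)
    have hl : DifferentiableAt ℝ (fun x : ℂ => x + starRingEnd ℂ x) z :=
      differentiableAt_fun_id.fun_add (differentiableAt_conj differentiableAt_fun_id)
    have hl' : DifferentiableAt ℝ (fun x : ℂ => x + starRingEnd ℂ x - 2 * a) z := hl.sub_const _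
    have hdl : dz (fun x : ℂ => x + starRingEnd ℂ x - 2 * a) z = 1 := by
      rw [dz_sub hl (differentiableAt_const _), dz_const, dz_add differentiableAt_fun_id
        (differentiableAt_conj differentiableAt_fun_id), dz_id, dz_id_conj]
      ring
    have hdq : dz (fun x => starRingEnd ℂ (quad a b x)) z = 0 := by
      rw [dz_conj (((quad_differentiable a b) z).restrictScalars ℝ),
        dzbar_of_differentiableAt ((quad_differentiable a b) z), map_zero]
    -- At `k = 0` the truncated index `k - 1` is harmless, because the factor `k` vanishes.
    have hk : (k : ℂ) * dz (sph (altSeq u (k - 1))) z = k * altSeq u k z := by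
      cases k with
      | zero => simp
      | succ k => rfl
    have h1 : altSeq (fun x => quad a b x * u x) (k + 1) z = _ :=
      dz_congr ((hW.eventually_mem hz).mono e)
    rw [h1, dz_add (hq.fun_mul hs) ((hl'.fun_mul hd).fun_add (hs1.const_mul _)), dz_mul hq hs,
      dz_add (hl'.fun_mul hd) (hs1.const_mul _), dz_mul hl' hd, dz_const_mul _ hs1, hk, hdq, hdl]
    -- Substituting for `∂ u_k` turns the coefficient `Q̄` of `u_{k+1}` into `Q̄ + (z + z̄ - 2a) (z
    -- - z̄) = Q`.
    have h2 := sub_conj_mul_altSeq_succ hW hWim hu hz (dzbar_altSeq hW hWim hu k hz)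
    change starRingEnd ℂ (quad a b z) * altSeq u (k + 1) z + _ + _ = _
    simp only [quad, map_add, map_sub, map_pow, Complex.conj_ofReal, Nat.add_sub_cancel]
    push_cast
    linear_combination (-(z + starRingEnd ℂ z - 2 * a)) * h2

theorem altSeq_congr {W : Set ℂ} (hW : IsOpen W) {u v : ℂ → ℂ} (h : Set.EqOn u v W) (k : ℕ) :
    Set.EqOn (altSeq u k) (altSeq v k) W := by
  induction k with
  | zero => exact h
  | succ k ih =>
    intro z hz
    refine dz_congr ((hW.eventually_mem hz).mono fun x hx => ?_)
    simp only [sph, ih hx]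

theorem altSeq_add {W : Set ℂ} (hW : IsOpen W) (hWim : ∀ z ∈ W, 0 < z.im) {u v : ℂ → ℂ}
    (hu : DifferentiableOn ℂ u W) (hv : DifferentiableOn ℂ v W) (k : ℕ) {z : ℂ} (hz : z ∈ W) :
    altSeq (fun x => u x + v x) k z = altSeq u k z + altSeq v k z := by
  induction k generalizing z with
  | zero => rfl
  | succ k ih =>
    have h1 : altSeq (fun x => u x + v x) (k + 1) z = _ :=
      dz_congr (v := fun x => sph (altSeq u k) x + sph (altSeq v k) x)
        ((hW.eventually_mem hz).mono fun x hx => by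
          simp only [sph, ih hx, Complex.add_im]; push_cast; ring)
    rw [h1, dz_add (sph_altSeq_differentiableAt hW hWim hu k hz)
      (sph_altSeq_differentiableAt hW hWim hv k hz)]
    rfl

theorem sph_linear (p q : ℝ) {z : ℂ} (hz : z.im ≠ 0) : sph (fun x => p + x * q) z = q := by
  simp [sph, hz]

theorem altSeq_linear {W : Set ℂ} (hW : IsOpen W) (hWim : ∀ z ∈ W, 0 < z.im) (p q : ℝ) (k : ℕ)
    {z : ℂ} (hz : z ∈ W) : altSeq (fun x => p + x * q) (k + 1) z = 0 := by
  induction k generalizing z with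
  | zero =>
    refine (dz_congr (v := fun _ => (q : ℂ)) ((hW.eventually_mem hz).mono fun x hx => ?_)).trans
      (dz_const _)
    exact sph_linear p q (hWim x hx).ne'
  | succ k ih =>
    refine (dz_congr (v := fun _ => 0) ((hW.eventually_mem hz).mono fun x hx => ?_)).trans
      (dz_const _)
    simp [sph, ih hx]

/-- The iterates at a root of the quadratic polynomial are determined by the expansion. -/
theorem altSeq_root {W : Set ℂ} (hW : IsOpen W) (hWim : ∀ z ∈ W, 0 < z.im) {a b : ℝ} {z₀ : ℂ}
    (hz₀ : z₀ ∈ W) (hroot : quad a b z₀ = 0) (hre : z₀.re = a) {p q : ℕ → ℝ} {U : ℕ → ℂ → ℂ}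
    (hU : ∀ m, DifferentiableOn ℂ (U m) W)
    (hrec : ∀ m, ∀ z ∈ W, U m z = (p m + z * q m) + quad a b z * U (m + 1) z) (k m : ℕ) :
    altSeq (U m) k z₀ = k.factorial * (p (m + k) + z₀ * q (m + k)) := by
  induction k generalizing m with
  | zero => simpa [altSeq, hroot] using hrec m z₀ hz₀
  | succ k ih =>
    have hq : DifferentiableOn ℂ (fun z => quad a b z * U (m + 1) z) W :=
      (quad_differentiable a b).differentiableOn.mul (hU _)
    have hl : DifferentiableOn ℂ (fun z : ℂ => (p m : ℂ) + z * q m) W := by fun_prop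
    have hsum : z₀ + starRingEnd ℂ z₀ - 2 * a = 0 := by
      rw [Complex.add_conj, hre]; push_cast; ring
    rw [altSeq_congr hW (hrec m) (k + 1) hz₀, altSeq_add hW hWim hl hq _ hz₀,
      altSeq_linear hW hWim _ _ _ hz₀, altSeq_quad_mul hW hWim (hU _) a b _ hz₀, hroot, hsum,
      Nat.add_sub_cancel, ih (m + 1), show m + 1 + k = m + (k + 1) by ring, Nat.factorial_succ]
    push_cast
    ring

/-! ### Coefficients of a pointwise convergent expansion -/

/-- If the expansion in powers of a quadratic polynomial with roots `a ± i b` converges near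
the roots, then its coefficients grow at most geometrically. -/
theorem exists_coeff_bound {a b r : ℝ} (hb : 0 < b) (hr : 0 < r) {p q : ℕ → ℝ} {u : ℂ → ℂ}
    (h : ∀ z, ‖quad a b z‖ < r ^ 2 →
      Tendsto (fun N => ∑ n ∈ Finset.range N, quad a b z ^ n * (p n + z * q n)) atTop
        (nhds (u z))) :
    ∃ t C : ℝ, 0 < t ∧ t < r ^ 2 ∧ ∀ n, t ^ n * |p n| ≤ C ∧ t ^ n * |q n| ≤ C := by
  -- With `t < b²` the equation `quad a b z = t` has the non-real root `z = a + i y`. As `t` is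
  -- real, the real and imaginary parts of the terms there control `p n + a * q n` and `y * q n`
  -- separately.
  set t := min (b ^ 2) (r ^ 2) / 2 with ht
  have hm : 0 < min (b ^ 2) (r ^ 2) := lt_min (by positivity) (by positivity)
  have ht0 : 0 < t := half_pos hm
  have htb : t < b ^ 2 := (half_lt_self hm).trans_le (min_le_left _ _)
  have htr : t < r ^ 2 := (half_lt_self hm).trans_le (min_le_right _ _)
  set y := Real.sqrt (b ^ 2 - t) with hy
  have hy0 : 0 < y := Real.sqrt_pos.2 (by linarith)
  have hy2 : y ^ 2 = b ^ 2 - t := Real.sq_sqrt (by linarith)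
  set z : ℂ := a + y * Complex.I with hz
  have hq : quad a b z = t := by
    have : ((y : ℂ)) ^ 2 = b ^ 2 - t := by exact_mod_cast hy2
    simp only [quad, hz]
    linear_combination (y : ℂ) ^ 2 * Complex.I_sq - this
  have hlim := h z (by rw [hq, Complex.norm_real, Real.norm_eq_abs, abs_of_pos ht0]; exact htr)
  have hterm : Tendsto (fun n => quad a b z ^ n * (p n + z * q n)) atTop (nhds 0) := by
    have h1 := ((tendsto_add_atTop_iff_nat 1).2 hlim).sub hlim
    simpa [Finset.sum_range_succ] using h1
  obtain ⟨C, hC⟩ := (Metric.isBounded_range_of_tendsto _ hterm).exists_norm_le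
  have hC' : ∀ n, ‖quad a b z ^ n * (p n + z * q n)‖ ≤ C := fun n => hC _ ⟨n, rfl⟩
  have e : ∀ n, quad a b z ^ n * (p n + z * q n) =
      ((t ^ n * (p n + a * q n) : ℝ) : ℂ) + ((t ^ n * (y * q n) : ℝ) : ℂ) * Complex.I := by
    intro n
    rw [hq, hz]; push_cast; ring
  have hre : ∀ n, |t ^ n * (p n + a * q n)| ≤ C := fun n => by
    refine le_trans ?_ (hC' n)
    rw [e]
    refine le_trans (le_of_eq ?_) (Complex.abs_re_le_norm _)
    simp only [Complex.add_re, Complex.ofReal_re, Complex.re_ofReal_mul, Complex.I_re]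
    congr 1; ring
  have him : ∀ n, |t ^ n * (y * q n)| ≤ C := fun n => by
    refine le_trans ?_ (hC' n)
    rw [e]
    refine le_trans (le_of_eq ?_) (Complex.abs_im_le_norm _)
    simp only [Complex.add_im, Complex.ofReal_im, Complex.im_ofReal_mul, Complex.I_im]
    congr 1; ring
  have hC0 : 0 ≤ C := (abs_nonneg _).trans (him 0)
  have hqn : ∀ n, t ^ n * |q n| ≤ C / y := fun n => by
    have := him n
    rw [abs_mul, abs_mul, abs_of_pos hy0, abs_of_pos (pow_pos ht0 n)] at this
    rw [le_div_iff₀ hy0]; linarith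
  refine ⟨t, C + (1 + |a|) * (C / y), ht0, htr, fun n => ⟨?_, ?_⟩⟩
  · have h1 : |p n| ≤ |p n + a * q n| + |a| * |q n| := by
      rw [← abs_mul]
      have := abs_sub (p n + a * q n) (a * q n)
      simpa using this
    have h2 := hre n
    rw [abs_mul, abs_of_pos (pow_pos ht0 n)] at h2
    have h3 := mul_le_mul_of_nonneg_left h1 (pow_pos ht0 n).le
    have h4 := mul_le_mul_of_nonneg_left (hqn n) (abs_nonneg a)
    have h5 : 0 ≤ C / y := by positivity
    linarith
  · have h5 : 0 ≤ |a| * (C / y) := by positivity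
    linarith [hqn n]

/-- The iterates at a root are determined by any pointwise convergent expansion. -/
theorem altSeq_eq_of_tendsto {a b r : ℝ} (hb : 0 < b) (hr : 0 < r) {p q : ℕ → ℝ} {u : ℂ → ℂ}
    (h : ∀ z, ‖quad a b z‖ < r ^ 2 →
      Tendsto (fun N => ∑ n ∈ Finset.range N, quad a b z ^ n * (p n + z * q n)) atTop
        (nhds (u z))) (k : ℕ) :
    altSeq u k ⟨a, b⟩ = k.factorial * (p k + (⟨a, b⟩ : ℂ) * q k) := by
  obtain ⟨t, C, ht, htr, hC⟩ := exists_coeff_bound hb hr h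
  set z₀ : ℂ := ⟨a, b⟩ with hz₀
  have hroot : quad a b z₀ = 0 := by
    have : z₀ = a + b * Complex.I := by rw [hz₀, Complex.mk_eq_add_mul_I]
    simp only [quad, this]
    linear_combination (b : ℂ) ^ 2 * Complex.I_sq
  set M := ‖z₀‖ + 1 with hM
  -- On this neighbourhood of `z₀` the bound `|Q| < t / 2` against coefficients of size `t⁻ⁿ` gives
  -- the ratio `1 / 2`, and `|z| < M` controls the linear factor.
  set W : Set ℂ := {z | 0 < z.im} ∩ ({z | ‖quad a b z‖ < t / 2} ∩ {z | ‖z‖ < M}) with hWdef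
  have hW : IsOpen W :=
    (isOpen_lt continuous_const Complex.continuous_im).inter
      ((isOpen_lt (quad_differentiable a b).continuous.norm continuous_const).inter
        (isOpen_lt continuous_norm continuous_const))
  have hWim : ∀ z ∈ W, 0 < z.im := fun z hz => hz.1
  have hz₀W : z₀ ∈ W := by
    refine ⟨hb, ?_, ?_⟩
    · simp only [Set.mem_ofPred_eq, hroot, norm_zero]; positivity
    · simp [hM]
  have hMpos : 0 < M := by positivity
  have hbound : ∀ m n, ∀ z ∈ W, ‖quad a b z ^ n * (p (m + n) + z * q (m + n))‖ ≤
      (C * (1 + M) / t ^ m) * (1 / 2) ^ n := by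
    intro m n z hz
    have h1 : ‖quad a b z‖ ≤ t / 2 := hz.2.1.le
    have h2 : ‖z‖ ≤ M := hz.2.2.le
    have hp := (hC (m + n)).1
    have hq := (hC (m + n)).2
    have h3 : ‖(p (m + n) + z * q (m + n) : ℂ)‖ ≤ |p (m + n)| + M * |q (m + n)| := by
      refine (norm_add_le _ _).trans ?_
      rw [norm_mul, Complex.norm_real, Complex.norm_real, Real.norm_eq_abs, Real.norm_eq_abs]
      gcongr
    rw [norm_mul, norm_pow]
    calc ‖quad a b z‖ ^ n * ‖(p (m + n) + z * q (m + n) : ℂ)‖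
        ≤ (t / 2) ^ n * (|p (m + n)| + M * |q (m + n)|) := by gcongr
      _ = (t ^ (m + n) * |p (m + n)| + M * (t ^ (m + n) * |q (m + n)|)) / t ^ m * (1 / 2) ^ n := by
        rw [pow_add, div_eq_mul_one_div t 2, mul_pow]; field_simp
      _ ≤ (C + M * C) / t ^ m * (1 / 2) ^ n := by gcongr
      _ = _ := by ring
  have hsumm : ∀ m, Summable fun n : ℕ => (C * (1 + M) / t ^ m) * (1 / 2 : ℝ) ^ n := fun m =>
    summable_geometric_two.mul_left _
  have hs : ∀ m, ∀ z ∈ W, Summable fun n => quad a b z ^ n * (p (m + n) + z * q (m + n)) :=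
    fun m z hz => Summable.of_norm_bounded (hsumm m) fun n => hbound m n z hz
  -- The tail of the series from index `m`, with the factor `Q ^ m` removed.
  set U : ℕ → ℂ → ℂ := fun m z => ∑' n, quad a b z ^ n * (p (m + n) + z * q (m + n)) with hU
  have hUd : ∀ m, DifferentiableOn ℂ (U m) W := fun m =>
    Complex.differentiableOn_tsum_of_summable_norm (hsumm m)
      (fun n => (((quad_differentiable a b).pow n).mul
        ((differentiable_id.mul_const _).const_add _)).differentiableOn) hW
      fun n z hz => hbound m n z hz
  have hrec : ∀ m, ∀ z ∈ W, U m z = (p m + z * q m) + quad a b z * U (m + 1) z := by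
    intro m z hz
    simp only [hU]
    rw [(hs m z hz).tsum_eq_zero_add, ← tsum_mul_left]
    simp only [pow_zero, one_mul, add_zero]
    congr 1
    refine tsum_congr fun n => ?_
    rw [show m + (n + 1) = m + 1 + n by ring]; ring
  have hU0 : Set.EqOn u (U 0) W := by
    intro z hz
    refine tendsto_nhds_unique (h z ?_) ?_
    · have : ‖quad a b z‖ < t / 2 := hz.2.1
      linarith
    · simpa [hU] using (hs 0 z hz).hasSum.tendsto_sum_nat
  rw [altSeq_congr hW hU0 k hz₀W, altSeq_root hW hWim hz₀W hroot rfl hUd hrec, zero_add]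

/-! ### Complex slices of the quaternions -/

theorem mul_self_of_mem {J : ℍ[ℝ]} (hJ : J ∈ imagUnits) : J * J = -1 := by
  rw [← sq]; exact hJ

theorem neg_mem_imagUnits {J : ℍ[ℝ]} (hJ : J ∈ imagUnits) : -J ∈ imagUnits := by
  change (-J) ^ 2 = -1
  rw [neg_sq]; exact hJ

theorem norm_of_mem {J : ℍ[ℝ]} (hJ : J ∈ imagUnits) : ‖J‖ = 1 := by
  have h := congrArg norm (mul_self_of_mem hJ)
  rw [norm_mul, norm_neg, norm_one] at h
  nlinarith [norm_nonneg J]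

theorem re_of_mem {J : ℍ[ℝ]} (hJ : J ∈ imagUnits) : J.re = 0 := by
  have h := mul_self_of_mem hJ
  have h0 := congrArg QuaternionAlgebra.re h
  have h1 := congrArg QuaternionAlgebra.imI h
  have h2 := congrArg QuaternionAlgebra.imJ h
  have h3 := congrArg QuaternionAlgebra.imK h
  simp at h0 h1 h2 h3
  by_contra hne
  have e1 : J.imI = 0 := by
    apply mul_left_cancel₀ hne; linarith
  have e2 : J.imJ = 0 := by
    apply mul_left_cancel₀ hne; linarith
  have e3 : J.imK = 0 := by
    apply mul_left_cancel₀ hne; linarith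
  rw [e1, e2, e3] at h0
  nlinarith [sq_nonneg J.re]

theorem star_of_mem {J : ℍ[ℝ]} (hJ : J ∈ imagUnits) : star J = -J :=
  Quaternion.star_eq_neg.2 (re_of_mem hJ)

/-- The embedding of `ℂ` in `ℍ` that maps `i` to the imaginary unit `J`. -/
noncomputable def slice (J : ℍ[ℝ]) (hJ : J ∈ imagUnits) : ℂ →ₐ[ℝ] ℍ[ℝ] :=
  Complex.liftAux J (mul_self_of_mem hJ)

theorem slice_apply {J : ℍ[ℝ]} (hJ : J ∈ imagUnits) (z : ℂ) :
    slice J hJ z = (z.re : ℍ[ℝ]) + J * (z.im : ℍ[ℝ]) := by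
  rw [slice, Complex.liftAux_apply, Quaternion.algebraMap_def, Quaternion.mul_coe_eq_smul]

theorem slice_mul_eq {J : ℍ[ℝ]} (hJ : J ∈ imagUnits) (z : ℂ) (v : ℍ[ℝ]) :
    slice J hJ z * v = z.re • v + J * (z.im • v) := by
  rw [slice_apply, add_mul, Quaternion.coe_mul_eq_smul, mul_assoc, Quaternion.coe_mul_eq_smul]

theorem slice_ofReal {J : ℍ[ℝ]} (hJ : J ∈ imagUnits) (t : ℝ) : slice J hJ (t : ℂ) = t := by
  simp

theorem star_slice {J : ℍ[ℝ]} (hJ : J ∈ imagUnits) (z : ℂ) :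
    star (slice J hJ z) = slice (-J) (neg_mem_imagUnits hJ) z := by
  simp only [slice_apply, star_add, star_mul, Quaternion.star_coe, star_of_mem hJ,
    Quaternion.coe_commutes]

theorem slice_neg {J : ℍ[ℝ]} (hJ : J ∈ imagUnits) (z : ℂ) :
    slice (-J) (neg_mem_imagUnits hJ) z = slice J hJ (starRingEnd ℂ z) := by
  simp [slice_apply]

theorem norm_slice {J : ℍ[ℝ]} (hJ : J ∈ imagUnits) (z : ℂ) : ‖slice J hJ z‖ = ‖z‖ := by
  have h : slice J hJ z * star (slice J hJ z) = ((Complex.normSq z : ℝ) : ℍ[ℝ]) := by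
    rw [star_slice hJ, slice_neg hJ, ← map_mul, Complex.mul_conj, slice_ofReal]
  rw [Quaternion.self_mul_star, Quaternion.coe_inj, Quaternion.normSq_eq_norm_mul_self,
    Complex.normSq_eq_norm_sq] at h
  nlinarith [norm_nonneg z, norm_nonneg (slice J hJ z)]

theorem re_slice {J : ℍ[ℝ]} (hJ : J ∈ imagUnits) (z : ℂ) : (slice J hJ z).re = z.re := by
  simp [slice_apply, re_of_mem hJ, Quaternion.mul_coe_eq_smul]

theorem im_slice {J : ℍ[ℝ]} (hJ : J ∈ imagUnits) (z : ℂ) : (slice J hJ z).im = z.im • J := by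
  have h := Quaternion.re_add_im (slice J hJ z)
  rw [re_slice] at h
  exact add_left_cancel (h.trans (by rw [slice_apply, Quaternion.mul_coe_eq_smul]))

theorem norm_im_slice {J : ℍ[ℝ]} (hJ : J ∈ imagUnits) (z : ℂ) :
    ‖(slice J hJ z).im‖ = |z.im| := by
  rw [im_slice, norm_smul, norm_of_mem hJ, mul_one, Real.norm_eq_abs]

theorem normalized_im_mem {x : ℍ[ℝ]} (hx : x.im ≠ 0) : ‖x.im‖⁻¹ • x.im ∈ imagUnits := by
  change (‖x.im‖⁻¹ • x.im) ^ 2 = -1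
  rw [smul_pow, Quaternion.im_sq, Quaternion.normSq_eq_norm_mul_self, ← Quaternion.coe_neg,
    Quaternion.smul_coe, inv_pow, ← sq, mul_neg, inv_mul_cancel₀ (by simpa using hx)]
  simp

theorem slice_normalized_im {x : ℍ[ℝ]} (hx : x.im ≠ 0) :
    slice _ (normalized_im_mem hx) ⟨x.re, ‖x.im‖⟩ = x := by
  rw [slice_apply, Quaternion.mul_coe_eq_smul, smul_smul, mul_inv_cancel₀ (by simpa using hx),
    one_smul, Quaternion.re_add_im]

theorem coe_I_mem : ((Complex.I : ℂ) : ℍ[ℝ]) ∈ imagUnits := by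
  change _ ^ 2 = _
  rw [sq, ← Quaternion.coeComplex_mul, Complex.I_mul_I]
  ext <;> simp

theorem slice_coe_I (z : ℂ) : slice _ coe_I_mem z = (z : ℍ[ℝ]) := by
  rw [slice_apply]
  ext <;> simp

theorem exists_slice (x : ℍ[ℝ]) : ∃ J, ∃ hJ : J ∈ imagUnits, slice J hJ ⟨x.re, ‖x.im‖⟩ = x := by
  by_cases hx : x.im = 0
  · refine ⟨_, coe_I_mem, ?_⟩
    conv_rhs => rw [← Quaternion.re_add_im x, hx]
    rw [slice_apply, hx]
    simp
  · exact ⟨_, _, slice_normalized_im hx⟩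

theorem charPoly_slice (q : ℍ[ℝ]) {J : ℍ[ℝ]} (hJ : J ∈ imagUnits) (z : ℂ) :
    charPoly q (slice J hJ z) = slice J hJ (quad q.re ‖q.im‖ z) := by
  have h1 : q * star q = ((q.re ^ 2 + ‖q.im‖ ^ 2 : ℝ) : ℍ[ℝ]) := by
    rw [Quaternion.self_mul_star, sq ‖q.im‖, ← Quaternion.normSq_eq_norm_mul_self,
      Quaternion.normSq_def', Quaternion.normSq_def', Quaternion.coe_inj]
    simp
    ring
  have h2 : q + star q = ((2 * q.re : ℝ) : ℍ[ℝ]) := by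
    rw [Quaternion.self_add_star]; push_cast; rfl
  rw [charPoly, h1, h2, ← slice_ofReal hJ, ← slice_ofReal hJ, ← map_pow, ← map_mul, ← map_sub,
    ← map_add, quad]
  congr 1
  push_cast
  ring

theorem norm_charPoly_slice (q : ℍ[ℝ]) {J : ℍ[ℝ]} (hJ : J ∈ imagUnits) (z : ℂ) :
    ‖charPoly q (slice J hJ z)‖ = ‖quad q.re ‖q.im‖ z‖ := by
  rw [charPoly_slice, norm_slice]

/-- A quaternion determines its complex parameter only up to conjugation, hence the need for
symmetry of `D`. -/
theorem mem_of_slice_mem {D : Set ℂ} (hD : ∀ z ∈ D, starRingEnd ℂ z ∈ D) {J : ℍ[ℝ]}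
    (hJ : J ∈ imagUnits) {z : ℂ} (h : slice J hJ z ∈ circularization D) : z ∈ D := by
  obtain ⟨w, hw, I, hI, e⟩ := h
  rw [← slice_apply hI] at e
  have h1 : z.re = w.re := by rw [← re_slice hJ, e, re_slice]
  have h2 : |z.im| = |w.im| := by rw [← norm_im_slice hJ, e, norm_im_slice]
  rcases abs_eq_abs.1 h2 with h | h
  · rwa [show z = w from Complex.ext h1 h]
  · rw [show z = starRingEnd ℂ w from Complex.ext h1 (by simpa using h)]
    exact hD w hw

theorem slice_mem {D : Set ℂ} {J : ℍ[ℝ]} (hJ : J ∈ imagUnits) {z : ℂ} (hz : z ∈ D) :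
    slice J hJ z ∈ circularization D :=
  ⟨z, hz, J, hJ, slice_apply hJ z⟩

/-- The terms of a spherical expansion on a slice. -/
theorem sphericalTerm_slice (q : ℍ[ℝ]) (s : ℕ → ℍ[ℝ]) {J : ℍ[ℝ]} (hJ : J ∈ imagUnits) (z : ℂ)
    (n : ℕ) {p : ℍ[ℝ]} (hp : s (2 * n) = p + q * s (2 * n + 1)) :
    sphericalTerm q s (slice J hJ z) n =
      ((quad q.re ‖q.im‖ z ^ n).re • p + (quad q.re ‖q.im‖ z ^ n * z).re • s (2 * n + 1)) +
      J * ((quad q.re ‖q.im‖ z ^ n).im • p + (quad q.re ‖q.im‖ z ^ n * z).im • s (2 * n + 1)) := by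
  have e : sphericalTerm q s (slice J hJ z) n = slice J hJ (quad q.re ‖q.im‖ z ^ n) * p +
      slice J hJ (quad q.re ‖q.im‖ z ^ n * z) * s (2 * n + 1) := by
    rw [sphericalTerm, charPoly_slice, hp, map_mul, map_pow]
    noncomm_ring
  rw [e, slice_mul_eq, slice_mul_eq, mul_add]
  abel

/-! ### Reduction of stem functions to complex components -/

/-- The real coordinates of a quaternion. -/
noncomputable def coord (j : Fin 4) : ℍ[ℝ] →L[ℝ] ℝ :=
  (EuclideanSpace.proj j : EuclideanSpace ℝ (Fin 4) →L[ℝ] ℝ).comp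
    (Quaternion.linearIsometryEquivTuple.toContinuousLinearEquiv :
      ℍ[ℝ] →L[ℝ] EuclideanSpace ℝ (Fin 4))

theorem coord_ext {x y : ℍ[ℝ]} (h : ∀ j, coord j x = coord j y) : x = y :=
  Quaternion.linearIsometryEquivTuple.injective (by ext j; exact h j)

/-- The quaternions with prescribed coordinates, as a continuous linear map. -/
noncomputable def ofCoord : (Fin 4 → ℝ) →L[ℝ] ℍ[ℝ] :=
  (Quaternion.linearIsometryEquivTuple.symm.toContinuousLinearEquiv :
      EuclideanSpace ℝ (Fin 4) →L[ℝ] ℍ[ℝ]).comp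
    ((EuclideanSpace.equiv (Fin 4) ℝ).symm : (Fin 4 → ℝ) →L[ℝ] EuclideanSpace ℝ (Fin 4))

theorem coord_ofCoord (v : Fin 4 → ℝ) (j : Fin 4) : coord j (ofCoord v) = v j := by
  change Quaternion.linearIsometryEquivTuple
    (Quaternion.linearIsometryEquivTuple.symm (WithLp.toLp 2 v)) j = v j
  rw [LinearIsometryEquiv.apply_symm_apply]

theorem ofCoord_coord (x : ℍ[ℝ]) : ofCoord (fun j => coord j x) = x :=
  coord_ext fun j => coord_ofCoord _ j

theorem hasSum_of_coord {g : ℕ → ℍ[ℝ]} {x : ℍ[ℝ]}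
    (h : ∀ j, HasSum (fun n => coord j (g n)) (coord j x)) : HasSum g x := by
  have h1 := ofCoord.hasSum (Pi.hasSum.2 h)
  simpa only [Function.comp_def, ofCoord_coord] using! h1

open Filter
/-- The complex valued component of a stem function along a real functional. -/
noncomputable def stemComp (l : ℍ[ℝ] →L[ℝ] ℝ) : ℍ[ℝ] × ℍ[ℝ] →L[ℝ] ℂ :=
  (Complex.equivRealProdCLM.symm : ℝ × ℝ →L[ℝ] ℂ).comp (l.prodMap l)

theorem stemComp_apply (l : ℍ[ℝ] →L[ℝ] ℝ) (w : ℍ[ℝ] × ℍ[ℝ]) :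
    stemComp l w = ⟨l w.1, l w.2⟩ := by
  apply Complex.ext <;> simp [stemComp]

theorem stemComp_mulSqrtNegOne (l : ℍ[ℝ] →L[ℝ] ℝ) (w : ℍ[ℝ] × ℍ[ℝ]) :
    stemComp l (mulSqrtNegOne w) = Complex.I * stemComp l w := by
  apply Complex.ext <;> simp [stemComp_apply, mulSqrtNegOne]

theorem stemComp_conj {D : Set ℂ} {F : ℂ → ℍ[ℝ] × ℍ[ℝ]} (hF : IsStem D F)
    (l : ℍ[ℝ] →L[ℝ] ℝ) {z : ℂ} (hz : z ∈ D) :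
    stemComp l (F (starRingEnd ℂ z)) = starRingEnd ℂ (stemComp l (F z)) := by
  rw [hF z hz]
  apply Complex.ext <;> simp [stemComp_apply]

theorem fderiv_stemComp (l : ℍ[ℝ] →L[ℝ] ℝ) {F : ℂ → ℍ[ℝ] × ℍ[ℝ]} {z : ℂ}
    (hF : DifferentiableAt ℝ F z) (v : ℂ) :
    fderiv ℝ (fun x => stemComp l (F x)) z v = stemComp l (fderiv ℝ F z v) := by
  have : fderiv ℝ (fun x => stemComp l (F x)) z = (stemComp l).comp (fderiv ℝ F z) :=
    ((stemComp l).hasFDerivAt.comp z hF.hasFDerivAt).fderiv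
  rw [this]; rfl

theorem stemComp_differentiableAt {D : Set ℂ} {F : ℂ → ℍ[ℝ] × ℍ[ℝ]}
    (hF : IsHolomorphicStem D F) (l : ℍ[ℝ] →L[ℝ] ℝ) {z : ℂ} (hz : z ∈ D) :
    DifferentiableAt ℂ (fun x => stemComp l (F x)) z := by
  obtain ⟨hd, hI⟩ := hF z hz
  refine differentiableAt_complex_iff_differentiableAt_real.2
    ⟨(stemComp l).differentiableAt.comp z hd, ?_⟩
  have h := hI 1
  rw [mul_one] at h
  rw [fderiv_stemComp l hd, fderiv_stemComp l hd, h, stemComp_mulSqrtNegOne, smul_eq_mul]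

theorem stemComp_wirtingerDeriv (l : ℍ[ℝ] →L[ℝ] ℝ) {F : ℂ → ℍ[ℝ] × ℍ[ℝ]} {z : ℂ}
    (hF : DifferentiableAt ℝ F z) :
    stemComp l (wirtingerDeriv F z) = dz (fun x => stemComp l (F x)) z := by
  rw [wirtingerDeriv, map_smul, map_sub, stemComp_mulSqrtNegOne, dz, fderiv_stemComp l hF,
    fderiv_stemComp l hF, Complex.real_smul]
  push_cast
  rfl

theorem contDiffOn_of_stemComp {W : Set ℂ} {F : ℂ → ℍ[ℝ] × ℍ[ℝ]}
    (h : ∀ j, ContDiffOn ℝ ∞ (fun x => stemComp (coord j) (F x)) W) : ContDiffOn ℝ ∞ F W := by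
  have h1 : ContDiffOn ℝ ∞ (fun x => fun j => coord j (F x).1) W :=
    contDiffOn_pi.2 fun j => (Complex.reCLM.contDiff.comp_contDiffOn (h j)).congr fun x _ => by
      simp [stemComp_apply]
  have h2 : ContDiffOn ℝ ∞ (fun x => fun j => coord j (F x).2) W :=
    contDiffOn_pi.2 fun j => (Complex.imCLM.contDiff.comp_contDiffOn (h j)).congr fun x _ => by
      simp [stemComp_apply]
  refine ((ofCoord.contDiff.comp_contDiffOn h1).prodMk
    (ofCoord.contDiff.comp_contDiffOn h2)).congr fun x _ => ?_
  simp only [Function.comp_def, ofCoord_coord]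

/-! ### Spherical and slice derivatives on stem functions -/

/-- The stem function of the spherical derivative of the slice function induced by `F`. -/
noncomputable def sphStem (F : ℂ → ℍ[ℝ] × ℍ[ℝ]) (z : ℂ) : ℍ[ℝ] × ℍ[ℝ] := (z.im⁻¹ • (F z).2, 0)

/-- The stem functions of the iterates of the composition of the spherical and the slice
derivative. -/
noncomputable def stemSeq (F : ℂ → ℍ[ℝ] × ℍ[ℝ]) : ℕ → ℂ → ℍ[ℝ] × ℍ[ℝ]
  | 0 => F
  | k + 1 => wirtingerDeriv (sphStem (stemSeq F k))

theorem stemComp_sphStem (l : ℍ[ℝ] →L[ℝ] ℝ) (F : ℂ → ℍ[ℝ] × ℍ[ℝ]) (z : ℂ) :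
    stemComp l (sphStem F z) = sph (fun x => stemComp l (F x)) z := by
  apply Complex.ext
  · simp only [stemComp_apply, sphStem, sph, map_smul, smul_eq_mul, Complex.ofReal_re,
      div_eq_inv_mul]
  · simp [stemComp_apply, sphStem, sph]

theorem contDiffOn_sphStem {W : Set ℂ} (hWim : ∀ z ∈ W, 0 < z.im) {F : ℂ → ℍ[ℝ] × ℍ[ℝ]}
    (hF : ContDiffOn ℝ ∞ F W) : ContDiffOn ℝ ∞ (sphStem F) W :=
  ((Complex.imCLM.contDiff.contDiffOn.inv fun z hz => (hWim z hz).ne').smul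
    (contDiff_snd.comp_contDiffOn hF)).prodMk contDiffOn_const

/-- Smoothness and the component formula go through one induction: differentiability of `sphStem
(stemSeq F k)` lets a functional pass through the Wirtinger derivative, and the resulting formula
gives smoothness of the next iterate by coordinates. -/
theorem stemComp_stemSeq {W : Set ℂ} (hW : IsOpen W) (hWim : ∀ z ∈ W, 0 < z.im)
    {F : ℂ → ℍ[ℝ] × ℍ[ℝ]} (hF : IsHolomorphicStem W F) (k : ℕ) :
    ContDiffOn ℝ ∞ (stemSeq F k) W ∧ ∀ l : ℍ[ℝ] →L[ℝ] ℝ, ∀ z ∈ W,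
      stemComp l (stemSeq F k z) = altSeq (fun x => stemComp l (F x)) k z := by
  have hd : ∀ l : ℍ[ℝ] →L[ℝ] ℝ, DifferentiableOn ℂ (fun x => stemComp l (F x)) W := fun l z hz =>
    (stemComp_differentiableAt hF l hz).differentiableWithinAt
  induction k with
  | zero =>
    exact ⟨contDiffOn_of_stemComp fun j =>
      contDiffOn_altSeq hW hWim (hd (coord j)) 0, fun l z _ => rfl⟩
  | succ k ih =>
    have hs := contDiffOn_sphStem hWim ih.1
    have h : ∀ l : ℍ[ℝ] →L[ℝ] ℝ, ∀ z ∈ W,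
        stemComp l (stemSeq F (k + 1) z) = altSeq (fun x => stemComp l (F x)) (k + 1) z := by
      intro l z hz
      refine (stemComp_wirtingerDeriv l
        ((hs.contDiffAt (hW.mem_nhds hz)).differentiableAt (by simp))).trans ?_
      refine dz_congr ((hW.eventually_mem hz).mono fun x hx => ?_)
      beta_reduce
      rw [stemComp_sphStem]
      simp only [sph, ih.2 l x hx]
    exact ⟨contDiffOn_of_stemComp fun j =>
      (contDiffOn_altSeq hW hWim (hd (coord j)) (k + 1)).congr fun z hz => h _ z hz, h⟩

theorem quaternion_two_ne_zero : (2 : ℍ[ℝ]) ≠ 0 := by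
  have h : ((2 : ℝ) : ℍ[ℝ]) ≠ 0 := by
    rw [Ne, ← Quaternion.coe_zero, Quaternion.coe_inj]
    exact two_ne_zero
  exact_mod_cast h

/-- The factor `J` cancels, so the spherical derivative is constant on each sphere; this is what
makes its stem function `sphStem`. -/
theorem sphericalDeriv_slice {g : ℍ[ℝ] → ℍ[ℝ]} {G : ℍ[ℝ] × ℍ[ℝ]} {z : ℂ} (hz : z.im ≠ 0)
    (hg : ∀ J, ∀ hJ : J ∈ imagUnits, g (slice J hJ z) = G.1 + J * G.2) {J : ℍ[ℝ]}
    (hJ : J ∈ imagUnits) : sphericalDeriv g (slice J hJ z) = z.im⁻¹ • G.2 := by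
  have hne : (2 * z.im • J : ℍ[ℝ]) ≠ 0 := by
    have hJ0 : J ≠ 0 := by
      intro h; simpa [h] using norm_of_mem hJ
    exact mul_ne_zero quaternion_two_ne_zero (smul_ne_zero hz hJ0)
  rw [sphericalDeriv, star_slice hJ, hg, hg, im_slice, inv_mul_eq_iff_eq_mul₀ hne,
    mul_smul_comm, mul_assoc, smul_mul_assoc, mul_smul_comm, smul_smul, inv_mul_cancel₀ hz,
    one_smul]
  noncomm_ring

theorem induced_slice (G : ℂ → ℍ[ℝ] × ℍ[ℝ]) {z : ℂ} (hz : 0 < z.im) {J : ℍ[ℝ]}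
    (hJ : J ∈ imagUnits) : induced G (slice J hJ z) = (G z).1 + J * (G z).2 := by
  have e : (⟨(slice J hJ z).re, ‖(slice J hJ z).im‖⟩ : ℂ) = z :=
    Complex.ext (re_slice hJ z) (by simp only [norm_im_slice, abs_of_pos hz])
  rw [induced, e, norm_im_slice, abs_of_pos hz, im_slice, smul_smul, inv_mul_cancel₀ hz.ne',
    one_smul]

/-- If `g` takes the same value at `z` and at `z̄`, its stem function is real there. -/
theorem stemOf_eq_of_symm {g : ℍ[ℝ] → ℍ[ℝ]} {z : ℂ} {v : ℍ[ℝ]}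
    (h : ∀ J, ∀ hJ : J ∈ imagUnits, g (slice J hJ z) = v) : stemOf g z = (v, 0) := by
  have h1 := h _ coe_I_mem
  have h2 := h _ (neg_mem_imagUnits coe_I_mem)
  rw [← star_slice coe_I_mem] at h2
  rw [slice_coe_I] at h1 h2
  rw [stemOf, h1, h2, sub_self, mul_zero, ← two_mul, inv_mul_cancel_left₀ quaternion_two_ne_zero]

/-- The iterates of the composition of the spherical and the slice derivative are slice functions
near non-real points. -/
theorem iterate_slice {D W : Set ℂ} (hW : IsOpen W) (hWim : ∀ z ∈ W, 0 < z.im) (hWD : W ⊆ D)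
    {F : ℂ → ℍ[ℝ] × ℍ[ℝ]} {f : ℍ[ℝ] → ℍ[ℝ]} (hf : Induces D F f) (k : ℕ) {z : ℂ} (hz : z ∈ W)
    {J : ℍ[ℝ]} (hJ : J ∈ imagUnits) :
    (sliceDeriv ∘ sphericalDeriv)^[k] f (slice J hJ z) =
      (stemSeq F k z).1 + J * (stemSeq F k z).2 := by
  induction k generalizing z J with
  | zero =>
    rw [Function.iterate_zero, id, slice_apply]
    exact hf z (hWD hz) J hJ
  | succ k ih =>
    rw [Function.iterate_succ_apply', Function.comp_apply, sliceDeriv,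
      induced_slice _ (hWim z hz) hJ]
    -- Equality is needed on a whole neighbourhood, since it is about to be differentiated.
    have e : stemOf (sphericalDeriv ((sliceDeriv ∘ sphericalDeriv)^[k] f)) =ᶠ[nhds z]
        sphStem (stemSeq F k) :=
      (hW.eventually_mem hz).mono fun x hx => stemOf_eq_of_symm fun J hJ =>
        sphericalDeriv_slice (hWim x hx).ne' (fun J hJ => ih hx hJ) hJ
    have e2 : wirtingerDeriv (stemOf (sphericalDeriv ((sliceDeriv ∘ sphericalDeriv)^[k] f))) z =
        stemSeq F (k + 1) z := by
      change _ = wirtingerDeriv (sphStem (stemSeq F k)) z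
      simp only [wirtingerDeriv, e.fderiv_eq]
    rw [e2]

/-! ### Existence of the spherical expansion -/

/-- Factorization of the quadratic polynomial. -/
theorem quad_eq_mul (z₀ z : ℂ) :
    quad z₀.re z₀.im z = (z - z₀) * (z - starRingEnd ℂ z₀) := by
  have h1 := Complex.add_conj z₀
  have h2 := Complex.mul_conj z₀
  rw [Complex.normSq_apply] at h2
  push_cast at h1 h2
  rw [quad]
  linear_combination z * h1 - h2

theorem exists_lemniscate_subset {D : Set ℂ} (hD : IsOpen D)
    (hDconj : ∀ z ∈ D, starRingEnd ℂ z ∈ D) {z₀ : ℂ} (hz₀ : z₀ ∈ D) (him : 0 < z₀.im) :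
    ∃ r, 0 < r ∧ r ≤ z₀.im ∧ ∀ z, ‖quad z₀.re z₀.im z‖ < r ^ 2 → z ∈ D := by
  obtain ⟨ε, hε, hball⟩ := Metric.isOpen_iff.1 hD z₀ hz₀
  refine ⟨min ε z₀.im, lt_min hε him, min_le_right _ _, fun z hz => ?_⟩
  have hr : 0 < min ε z₀.im := lt_min hε him
  rw [quad_eq_mul, norm_mul] at hz
  by_cases h1 : ‖z - z₀‖ < min ε z₀.im
  · exact hball (mem_ball_iff_norm.2 (h1.trans_le (min_le_left _ _)))
  -- The product of the distances to `z₀` and `z̄₀` is below `r²`, so one of them is below `r`;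
  -- symmetry of `D` covers the second case.
  · have h2 : ‖z - starRingEnd ℂ z₀‖ < min ε z₀.im := by
      by_contra h2
      rw [not_lt] at h1 h2
      nlinarith [mul_le_mul h1 h2 hr.le (norm_nonneg _)]
    rw [← Complex.conj_conj z]
    refine hDconj _ (hball (mem_ball_iff_norm.2 ?_))
    rw [← RCLike.norm_conj, map_sub, Complex.conj_conj]
    exact h2.trans_le (min_le_left _ _)

theorem IsHolomorphicStem.mono {D W : Set ℂ} {F : ℂ → ℍ[ℝ] × ℍ[ℝ]} (h : IsHolomorphicStem D F)
    (hW : W ⊆ D) : IsHolomorphicStem W F := fun z hz => h z (hW hz)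

theorem exists_spherical_expansion {D : Set ℂ} {F : ℂ → ℍ[ℝ] × ℍ[ℝ]} {f : ℍ[ℝ] → ℍ[ℝ]}
    (hF : IsStem D F) (hol : IsHolomorphicStem D F) (hf : Induces D F f) (q₀ : ℍ[ℝ]) {r : ℝ}
    (hr : 0 < r) (hrb : r ≤ ‖q₀.im‖) (hU : ∀ z, ‖quad q₀.re ‖q₀.im‖ z‖ < r ^ 2 → z ∈ D) :
    ∃ s : ℕ → ℍ[ℝ], ∀ x ∈ cassiniBall q₀ r, HasSum (sphericalTerm q₀ s x) (f x) := by
  choose p q hpq using fun j => exists_real_expansion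
    (fun z hz => stemComp_differentiableAt hol (coord j) hz)
    (fun z hz => stemComp_conj hF (coord j) hz) hr hrb hU
  set P : ℕ → ℍ[ℝ] := fun n => ofCoord fun j => p j n
  set Q : ℕ → ℍ[ℝ] := fun n => ofCoord fun j => q j n
  -- Solves `s (2n) - q₀ * s (2n+1) = P n` and `s (2n+1) = Q n`.
  refine ⟨fun n => if Even n then P (n / 2) + q₀ * Q (n / 2) else Q (n / 2), fun x hx => ?_⟩
  obtain ⟨J, hJ, e⟩ := exists_slice x
  set z : ℂ := ⟨x.re, ‖x.im‖⟩
  have hz : ‖quad q₀.re ‖q₀.im‖ z‖ < r ^ 2 := by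
    rw [← norm_charPoly_slice q₀ hJ, e]; exact hx
  rw [← e, slice_apply hJ, hf z (hU z hz) J hJ, ← slice_apply hJ]
  have hodd : ∀ n, (2 * n + 1) / 2 = n := fun n => by omega
  have hterm := fun n => sphericalTerm_slice q₀
    (fun n => if Even n then P (n / 2) + q₀ * Q (n / 2) else Q (n / 2)) hJ z n (p := P n)
    (by simp [hodd])
  rw [show sphericalTerm q₀ _ (slice J hJ z) = _ from funext hterm]
  simp only [Nat.not_even_two_mul_add_one, if_false, hodd]
  refine HasSum.add (hasSum_of_coord fun j => ?_) ((hasSum_of_coord fun j => ?_).mul_left J)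
  · have h := Complex.reCLM.hasSum (hpq j z hz)
    simp only [stemComp_apply, Complex.reCLM_apply] at h
    refine Eq.subst (motive := fun G => HasSum G _) (funext fun n => ?_) h
    simp only [P, Q, map_add, map_smul, coord_ofCoord, smul_eq_mul,
      mul_add, ← mul_assoc, Complex.add_re, Complex.re_mul_ofReal]
  · have h := Complex.imCLM.hasSum (hpq j z hz)
    simp only [stemComp_apply, Complex.imCLM_apply] at h
    refine Eq.subst (motive := fun G => HasSum G _) (funext fun n => ?_) h
    simp only [P, Q, map_add, map_smul, coord_ofCoord, smul_eq_mul,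
      mul_add, ← mul_assoc, Complex.add_im, Complex.im_mul_ofReal]

/-! ### Determination of the coefficients -/

/-- Convergence of `X N + J Y N` for `J` and `-J` is convergence of `X` and `Y`. -/
theorem tendsto_of_tendsto_slices {X Y : ℕ → ℍ[ℝ]} {x y J : ℍ[ℝ]} (hJ : J ∈ imagUnits)
    (h1 : Tendsto (fun N => X N + J * Y N) atTop (nhds (x + J * y)))
    (h2 : Tendsto (fun N => X N + -J * Y N) atTop (nhds (x + -J * y))) :
    Tendsto X atTop (nhds x) ∧ Tendsto Y atTop (nhds y) := by
  have hX : ∀ a b : ℍ[ℝ], (2⁻¹ : ℝ) • ((a + J * b) + (a + -J * b)) = a := fun a b => by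
    rw [neg_mul, add_add_add_comm, add_neg_cancel, add_zero, ← two_smul ℝ, smul_smul]
    norm_num
  have hY : ∀ a b : ℍ[ℝ], (2⁻¹ : ℝ) • (-J * ((a + J * b) - (a + -J * b))) = b := fun a b => by
    have : -J * ((a + J * b) - (a + -J * b)) = (2 : ℝ) • (-(J * J) * b) := by
      rw [two_smul]; noncomm_ring
    rw [this, mul_self_of_mem hJ, neg_neg, one_mul, smul_smul]
    norm_num
  constructor
  · simpa only [hX] using (h1.add h2).const_smul (2⁻¹ : ℝ)
  · simpa only [hY] using ((h1.sub h2).const_mul (-J)).const_smul (2⁻¹ : ℝ)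

/-- The slices of `i` and `-i` already separate the two stem components; a real functional then
commutes with the real multipliers in each of them. -/
theorem tendsto_stemComp {D : Set ℂ} {F : ℂ → ℍ[ℝ] × ℍ[ℝ]} {f : ℍ[ℝ] → ℍ[ℝ]}
    (hf : Induces D F f) {q₀ : ℍ[ℝ]} {s : ℕ → ℍ[ℝ]} {z : ℂ} (hz : z ∈ D)
    (h : ∀ J, ∀ hJ : J ∈ imagUnits, Tendsto (fun N : ℕ => ∑ n ∈ Finset.range N,
      sphericalTerm q₀ s (slice J hJ z) n) atTop (nhds (f (slice J hJ z)))) (l : ℍ[ℝ] →L[ℝ] ℝ) :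
    Tendsto (fun N : ℕ => ∑ n ∈ Finset.range N, quad q₀.re ‖q₀.im‖ z ^ n *
      ((l (s (2 * n) - q₀ * s (2 * n + 1)) : ℝ) + z * (l (s (2 * n + 1)) : ℝ))) atTop
      (nhds (stemComp l (F z))) := by
  have key : ∀ J, J ∈ imagUnits → Tendsto (fun N : ℕ =>
      ∑ n ∈ Finset.range N, ((quad q₀.re ‖q₀.im‖ z ^ n).re • (s (2 * n) - q₀ * s (2 * n + 1)) +
        (quad q₀.re ‖q₀.im‖ z ^ n * z).re • s (2 * n + 1)) +
      J * ∑ n ∈ Finset.range N,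
        ((quad q₀.re ‖q₀.im‖ z ^ n).im • (s (2 * n) - q₀ * s (2 * n + 1)) +
        (quad q₀.re ‖q₀.im‖ z ^ n * z).im • s (2 * n + 1))) atTop
      (nhds ((F z).1 + J * (F z).2)) := by
    intro J hJ
    have h1 := h J hJ
    rw [slice_apply hJ, hf z hz J hJ, ← slice_apply hJ] at h1
    refine h1.congr fun N => ?_
    rw [Finset.mul_sum, ← Finset.sum_add_distrib]
    exact Finset.sum_congr rfl fun n _ => sphericalTerm_slice q₀ s hJ z n (by abel)
  obtain ⟨hX, hY⟩ := tendsto_of_tendsto_slices coe_I_mem (key _ coe_I_mem)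
    (key _ (neg_mem_imagUnits coe_I_mem))
  have h2 := ((stemComp l).continuous.tendsto _).comp (hX.prodMk_nhds hY)
  refine h2.congr fun N => ?_
  rw [Function.comp_apply, stemComp_apply]
  apply Complex.ext
  · simp only [map_sum, Complex.re_sum, map_add, map_smul, smul_eq_mul, mul_add, ← mul_assoc,
      Complex.add_re, Complex.re_mul_ofReal]
  · simp only [map_sum, Complex.im_sum, map_add, map_smul, smul_eq_mul, mul_add, ← mul_assoc,
      Complex.add_im, Complex.im_mul_ofReal]

/-- These are the real and imaginary parts, in each coordinate, of `k! (p_k + z₀ q_k)` with `z₀ = Re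
q₀ + i |Im q₀|`. -/
theorem stemSeq_eq_of_tendsto {D : Set ℂ} (hD : IsOpen D) {F : ℂ → ℍ[ℝ] × ℍ[ℝ]}
    {f : ℍ[ℝ] → ℍ[ℝ]} (hol : IsHolomorphicStem D F) (hf : Induces D F f) {q₀ : ℍ[ℝ]}
    (hq₀ : q₀.im ≠ 0) {r : ℝ} (hr : 0 < r) (hU : ∀ z, ‖quad q₀.re ‖q₀.im‖ z‖ < r ^ 2 → z ∈ D)
    {s : ℕ → ℍ[ℝ]} (hs : ∀ x ∈ cassiniBall q₀ r,
      Tendsto (fun N : ℕ => ∑ n ∈ Finset.range N, sphericalTerm q₀ s x n) atTop (nhds (f x)))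
    (hz₀ : (⟨q₀.re, ‖q₀.im‖⟩ : ℂ) ∈ D) (k : ℕ) :
    stemSeq F k ⟨q₀.re, ‖q₀.im‖⟩ =
      ((k.factorial : ℝ) • (s (2 * k) - q₀ * s (2 * k + 1) + q₀.re • s (2 * k + 1)),
        (k.factorial : ℝ) • (‖q₀.im‖ • s (2 * k + 1))) := by
  have hb : 0 < ‖q₀.im‖ := norm_pos_iff.2 hq₀
  have hW : IsOpen (D ∩ {z | 0 < z.im}) :=
    hD.inter (isOpen_lt continuous_const Complex.continuous_im)
  have h : ∀ l : ℍ[ℝ] →L[ℝ] ℝ, stemComp l (stemSeq F k ⟨q₀.re, ‖q₀.im‖⟩) =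
      k.factorial * ((l (s (2 * k) - q₀ * s (2 * k + 1)) : ℝ) +
        (⟨q₀.re, ‖q₀.im‖⟩ : ℂ) * (l (s (2 * k + 1)) : ℝ)) := by
    intro l
    rw [(stemComp_stemSeq hW (fun z hz => hz.2) (hol.mono Set.inter_subset_left) k).2 l _
      ⟨hz₀, hb⟩]
    refine altSeq_eq_of_tendsto hb hr (p := fun n => l (s (2 * n) - q₀ * s (2 * n + 1)))
      (q := fun n => l (s (2 * n + 1))) (fun z hz => ?_) k
    refine tendsto_stemComp hf (hU z hz) (fun J hJ => hs _ ?_) l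
    change ‖_‖ < _
    rwa [norm_charPoly_slice]
  refine Prod.ext (coord_ext fun j => ?_) (coord_ext fun j => ?_)
  · have h1 := congrArg Complex.re (h (coord j))
    rw [stemComp_apply, ← Complex.ofReal_natCast, Complex.re_ofReal_mul, Complex.add_re,
      Complex.re_mul_ofReal, Complex.ofReal_re] at h1
    simp only [map_smul, map_add, smul_eq_mul]
    exact h1
  · have h1 := congrArg Complex.im (h (coord j))
    rw [stemComp_apply, ← Complex.ofReal_natCast, Complex.im_ofReal_mul, Complex.add_im,
      Complex.im_mul_ofReal, Complex.ofReal_im, zero_add] at h1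
    simp only [map_smul, smul_eq_mul]
    exact h1

end SliceRegular

/-- At a non-real point `q₀`, a slice regular function has a spherical expansion on some Cassini
ball, and the coefficients of any such expansion are the alternate derivatives. -/
theorem theorem4p1 (D : Set ℂ) (hD : IsOpen D) (hDconj : ∀ z ∈ D, starRingEnd ℂ z ∈ D)
    (f : ℍ[ℝ] → ℍ[ℝ]) (hf : SliceRegular.IsSliceRegular D f)
    (q₀ : ℍ[ℝ]) (hq₀ : q₀ ∈ SliceRegular.circularization D) (hq₀_im : q₀.im ≠ 0) :
    (∃ r : ℝ, 0 < r ∧ SliceRegular.cassiniBall q₀ r ⊆ SliceRegular.circularization D ∧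
      ∃ s : ℕ → ℍ[ℝ], ∀ x ∈ SliceRegular.cassiniBall q₀ r,
        HasSum (SliceRegular.sphericalTerm q₀ s x) (f x)) ∧
    ∀ r : ℝ, 0 < r → SliceRegular.cassiniBall q₀ r ⊆ SliceRegular.circularization D →
      ∀ s : ℕ → ℍ[ℝ],
        (∀ x ∈ SliceRegular.cassiniBall q₀ r,
          Filter.Tendsto (fun N : ℕ => ∑ n ∈ Finset.range N, SliceRegular.sphericalTerm q₀ s x n)
            Filter.atTop (nhds (f x))) →
        ∀ k : ℕ,
          s (2 * k) = ((k.factorial : ℝ)⁻¹) •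
            ((SliceRegular.sliceDeriv ∘ SliceRegular.sphericalDeriv)^[k] f) q₀ ∧
          s (2 * k + 1) = ((k.factorial : ℝ)⁻¹) •
            SliceRegular.sphericalDeriv
              ((SliceRegular.sliceDeriv ∘ SliceRegular.sphericalDeriv)^[k] f) q₀ := by
  open SliceRegular in
  obtain ⟨F, hF, hol, hind⟩ := hf
  have hb : 0 < ‖q₀.im‖ := norm_pos_iff.2 hq₀_im
  have hz₀ : (⟨q₀.re, ‖q₀.im‖⟩ : ℂ) ∈ D :=
    mem_of_slice_mem hDconj (normalized_im_mem hq₀_im) (by rwa [slice_normalized_im hq₀_im])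
  refine ⟨?_, ?_⟩
  · obtain ⟨r, hr, hrb, hU⟩ := exists_lemniscate_subset hD hDconj hz₀ hb
    refine ⟨r, hr, fun x hx => ?_,
      exists_spherical_expansion hF hol hind q₀ hr hrb hU⟩
    obtain ⟨J, hJ, e⟩ := exists_slice x
    rw [← e]
    refine slice_mem hJ (hU _ ?_)
    rw [← norm_charPoly_slice q₀ hJ, e]
    exact hx
  · intro r hr hsub s hs k
    have hU : ∀ z, ‖quad q₀.re ‖q₀.im‖ z‖ < r ^ 2 → z ∈ D := fun z hz => by
      refine mem_of_slice_mem hDconj coe_I_mem (hsub ?_)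
      change ‖_‖ < _
      rwa [norm_charPoly_slice]
    have hG := stemSeq_eq_of_tendsto hD hol hind hq₀_im hr hU hs hz₀ k
    have hval : ∀ J, ∀ hJ : J ∈ imagUnits, (sliceDeriv ∘ sphericalDeriv)^[k] f
        (slice J hJ ⟨q₀.re, ‖q₀.im‖⟩) = (stemSeq F k ⟨q₀.re, ‖q₀.im‖⟩).1 +
          J * (stemSeq F k ⟨q₀.re, ‖q₀.im‖⟩).2 := fun J hJ =>
      iterate_slice (hD.inter (isOpen_lt continuous_const Complex.continuous_im))
        (fun z hz => hz.2) Set.inter_subset_left hind k ⟨hz₀, hb⟩ hJ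
    have hI := normalized_im_mem hq₀_im
    have hk : (k.factorial : ℝ) ≠ 0 := by exact_mod_cast k.factorial_ne_zero
    have e := slice_normalized_im hq₀_im
    have h1 := hval _ hI
    have h2 := sphericalDeriv_slice hb.ne' hval hI
    rw [e, hG] at h1 h2
    rw [h1, h2]
    dsimp only
    constructor
    -- The decomposition `q₀ = Re q₀ + I |Im q₀|` reassembles `q₀ * s (2k+1)`, which cancels the one
    -- subtracted in `p_k`.
    · have h3 : q₀ * s (2 * k + 1) = q₀.re • s (2 * k + 1) +
          (‖q₀.im‖⁻¹ • q₀.im) * (‖q₀.im‖ • s (2 * k + 1)) := by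
        rw [← slice_mul_eq hI ⟨q₀.re, ‖q₀.im‖⟩, e]
      rw [mul_smul_comm, ← smul_add, smul_smul, inv_mul_cancel₀ hk, one_smul, add_assoc, ← h3,
        sub_add_cancel]
    · rw [smul_comm (‖q₀.im‖⁻¹), smul_smul, inv_mul_cancel₀ hk, one_smul, smul_smul,
        inv_mul_cancel₀ hb.ne', one_smul]
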